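/- Let $\mathcal{CL}\subset\mathbb{P}^2_{\mathbb{C}}$ be an arrangement of $d\ge 3$ pairwise distinct lines and one smooth conic, all of whose singular points are ordinary (the curves of $\mathcal{CL}$ through the point have pairwise distinct tangent lines there) of multiplicity at most $4$. Let $f\in\mathbb{C}[x,y,z]$ be the product of the equations of these $d+1$ curves, and let $J_f$ be the ideal generated by the three partial derivatives of $f$. Assume that $\mathcal{CL}$ is an $\mathscr{M}$-arrangement, i.e. that the degree of $J_f$ (the constant value of $\dim_{\mathbb{C}}(\mathbb{C}[x,y,z]/J_f)_j$ for all large $j$) is $$\deg J_f=\begin{cases}3m^2-3m+3 & \text{if } \deg f=d+2=2m,\\ 3m^2+1 & \text{if } \deg f=d+2=2m+1.\end{cases}$$ For $r\ge2$ let $n_r$ be the number of points of $\mathbb{P}^2_{\mathbb{C}}$ in which exactly $r$ of the curves of $\mathcal{CL}$ meet. (i) If $d=2\ell$ (so $\ell\ge2$), then $n_2+n_3=3\ell-6$ and $n_3+3n_4=\ell^2+3$. (ii) If $d=2\ell+1$ (so $\ell\ge1$), then $n_2+n_3=3\ell-2$ and $n_3+3n_4=\ell^2+\ell+2$. -/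

import Mathlib

open MvPolynomial Filter
open scoped LinearAlgebra.Projectivization

/-- The complex projective plane. -/
abbrev ProjPlane : Type := ℙ ℂ (Fin 3 → ℂ)

/-- The homogeneous coordinate ring `ℂ[x, y, z]` of the projective plane. -/
abbrev PlaneRing : Type := MvPolynomial (Fin 3) ℂ

/-- The gradient of a polynomial at a vector of `ℂ³`. -/
noncomputable def gradientAt (g : PlaneRing) (v : Fin 3 → ℂ) : Fin 3 → ℂ :=
  fun i => eval v (pderiv i g)

/-- The Jacobian ideal of `f`, generated by the three partial derivatives of `f`. -/
noncomputable def jacobianIdeal (f : PlaneRing) : Ideal PlaneRing :=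
  Ideal.span (Set.range fun i : Fin 3 => pderiv i f)

/-- The Hilbert function of `ℂ[x, y, z] / I` for a homogeneous ideal `I`: the dimension of the
degree `j` part of the quotient, i.e. of the image of the space of forms of degree `j`. -/
noncomputable def quotientHilbertFunction (I : Ideal PlaneRing) (j : ℕ) : ℕ :=
  Module.finrank ℂ
    ((homogeneousSubmodule (Fin 3) ℂ j).map (Ideal.Quotient.mkₐ ℂ I).toLinearMap)

/-- The homogeneous ideal `I` defines a subscheme of dimension at most zero of the projective
plane, and this subscheme has degree `t`: the Hilbert polynomial of `ℂ[x, y, z] / I` is the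
constant `t`. -/
def HasZeroDimDegree (I : Ideal PlaneRing) (t : ℕ) : Prop :=
  ∀ᶠ j in atTop, quotientHilbertFunction I j = t

/-- An arrangement of `d` lines and `k` smooth conics in the complex projective plane, the lines
being pairwise distinct and the conics being pairwise distinct. Each curve is given by an equation
(which the curve determines up to a nonzero scalar factor). -/
structure ConicLineArrangement (d k : ℕ) where
  line : Fin d → PlaneRing
  conic : Fin k → PlaneRing
  line_homogeneous : ∀ i, (line i).IsHomogeneous 1
  line_ne_zero : ∀ i, line i ≠ 0
  line_distinct : ∀ i j, i ≠ j → ¬ Associated (line i) (line j)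
  conic_homogeneous : ∀ i, (conic i).IsHomogeneous 2
  conic_smooth : ∀ i, ∀ v : Fin 3 → ℂ, v ≠ 0 → eval v (conic i) = 0 → gradientAt (conic i) v ≠ 0
  conic_distinct : ∀ i j, i ≠ j → ¬ Associated (conic i) (conic j)

namespace ConicLineArrangement

variable {d k : ℕ}

/-- The equations of all the curves of the arrangement. -/
def curve (A : ConicLineArrangement d k) : Fin d ⊕ Fin k → PlaneRing :=
  Sum.elim A.line A.conic

/-- The defining polynomial of the arrangement: the product of the equations of its curves. -/
noncomputable def poly (A : ConicLineArrangement d k) : PlaneRing :=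
  ∏ c, A.curve c

/-- The degree of the union of `d` lines and `k` conics. -/
def degree (_A : ConicLineArrangement d k) : ℕ := d + 2 * k

/-- The curves of the arrangement that pass through the point `p`. (The vanishing of a form at a
representative vector does not depend on the representative.) -/
def curvesThrough (A : ConicLineArrangement d k) (p : ProjPlane) : Set (Fin d ⊕ Fin k) :=
  {c | eval p.rep (A.curve c) = 0}

/-- The multiplicity of a point on the arrangement: as all the curves are smooth, it is the number
of curves through the point. -/
noncomputable def multiplicity (A : ConicLineArrangement d k) (p : ProjPlane) : ℕ :=
  (A.curvesThrough p).ncard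

/-- `p` is an ordinary point of the arrangement: the curves through `p` have pairwise different
tangent lines at `p`. (The tangent line at `p` of a curve `g = 0` that is smooth at `p` is the line
whose coefficient vector is the gradient of `g` at `p`.) -/
def IsOrdinaryAt (A : ConicLineArrangement d k) (p : ProjPlane) : Prop :=
  ∀ c ∈ A.curvesThrough p, ∀ c' ∈ A.curvesThrough p, c ≠ c' →
    LinearIndependent ℂ ![gradientAt (A.curve c) p.rep, gradientAt (A.curve c') p.rep]

/-- All the singular points of the arrangement are ordinary, of multiplicity at most `m`. -/
def HasOrdinarySingularitiesLE (A : ConicLineArrangement d k) (m : ℕ) : Prop :=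
  ∀ p : ProjPlane, 2 ≤ A.multiplicity p → A.IsOrdinaryAt p ∧ A.multiplicity p ≤ m

/-- `n_r`: the number of points of the plane in which exactly `r` curves of the arrangement meet.
(For `r ≥ 2` there are only finitely many of them.) -/
noncomputable def numPoints (A : ConicLineArrangement d k) (r : ℕ) : ℕ :=
  {p : ProjPlane | A.multiplicity p = r}.ncard

/-- The arrangement is an `𝓜`-arrangement with only ordinary singularities of multiplicity at most
four. The singularities allowed on an `𝓜`-curve are the ADE ones and the simple elliptic ones;
ordinary double and triple points are the singularities `A₁` and `D₄`, and ordinary quadruple points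
are simple elliptic, so that the first field takes the place of this requirement. The union of the
curves is reduced, since the curves are irreducible and pairwise distinct. The last two fields say
that the Jacobian ideal has the degree required of an `𝓜`-curve. -/
structure IsOrdinaryMArrangement (A : ConicLineArrangement d k) : Prop where
  ordinary : A.HasOrdinarySingularitiesLE 4
  five_le_degree : 5 ≤ A.degree
  degree_even : ∀ m : ℕ, A.degree = 2 * m →
    HasZeroDimDegree (jacobianIdeal A.poly) (3 * m ^ 2 - 3 * m + 3)
  degree_odd : ∀ m : ℕ, A.degree = 2 * m + 1 →
    HasZeroDimDegree (jacobianIdeal A.poly) (3 * m ^ 2 + 1)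

end ConicLineArrangement

/-!
The two equations come from two ways of counting over the singular points `p` of the arrangement,
where `r_p ≤ 4` curves meet with different tangent lines.

* Bézout: two lines meet in one point, and a line and the conic meet in two points because they are
  nowhere tangent. Counting pairs of curves gives `n₂ + 3 n₃ + 6 n₄ = d (d - 1) / 2 + 2 d`
  (`ConicLineArrangement.sum_multiplicity_mul_pred`).
* The degree of the Jacobian ideal `J` of the equation `f` is the sum of the `(r_p - 1)²`, that is
  `n₂ + 4 n₃ + 9 n₄` (`ConicLineArrangement.hasZeroDimDegree_jacobianIdeal_poly`). By hypothesis it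
  has a prescribed value, and the claim follows by linear algebra.

The second count is local at each point and then globalized. In an affine chart centred at `p` the
curve has an equation `F ∈ ℂ[s, t]` of order `r` whose leading form `G` is a product of `r`
pairwise non-proportional linear forms. Such a `G` has no relation `A G_s + B G_t = 0` of degree at
most `r - 2` (`hasIndependentPartials_prod`). Comparing dimensions in degree `2 r - 3` and using
Nakayama's lemma, `F_s` and `F_t` generate all terms of order `2 r - 3` locally
(`exists_mul_truncatedJacobian_le`), and the quotient by `(F_s, F_t) + (s, t)^(2 r - 3)` has
dimension `(r - 1)²` (`finrank_quotient_truncatedJacobian`). For `r ≤ 4` this ideal contains `F`, by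
Euler's formula for `G` (`self_mem_truncatedJacobian`), so it is the local Jacobian ideal.

For the passage to `ℂ[x, y, z]`, forms of large degree restrict to arbitrary elements of the product
of these local quotients (`exists_isHomogeneous_chart_sub_mem`). A form whose restrictions all
vanish belongs to `J` locally at every point, hence to the saturation of `J`, which agrees with `J`
in large degrees by the Nullstellensatz (`exists_forall_mem_of_mem_pointwiseSaturation`).
-/

/-! ### Order and leading forms of polynomials -/

section LeadingForms

variable {σ : Type*}

theorem homogeneousComponent_eq_zero_of_mem_pow {p : MvPolynomial σ ℂ} {a n : ℕ}
    (hp : p ∈ idealOfVars σ ℂ ^ a) (hn : n < a) : homogeneousComponent n p = 0 := by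
  ext x
  rw [coeff_homogeneousComponent, coeff_zero]
  split_ifs with h
  · exact (mem_pow_idealOfVars_iff' a p).1 hp x (by omega)
  · rfl

theorem mem_pow_of_isHomogeneous {p : MvPolynomial σ ℂ} {a n : ℕ}
    (hp : p.IsHomogeneous n) (h : a ≤ n) : p ∈ idealOfVars σ ℂ ^ a := by
  rw [mem_pow_idealOfVars_iff']
  intro x hx
  exact hp.coeff_eq_zero (by omega)

theorem sub_homogeneousComponent_mem {p : MvPolynomial σ ℂ} {a : ℕ}
    (hp : p ∈ idealOfVars σ ℂ ^ a) :
    p - homogeneousComponent a p ∈ idealOfVars σ ℂ ^ (a + 1) := by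
  rw [mem_pow_idealOfVars_iff'] at hp ⊢
  intro x hx
  rw [coeff_sub, coeff_homogeneousComponent]
  split_ifs with h
  · simp
  · simpa using hp x (by omega)

theorem mem_pow_succ_of_homogeneousComponent_eq_zero {p : MvPolynomial σ ℂ} {a : ℕ}
    (hp : p ∈ idealOfVars σ ℂ ^ a) (h : homogeneousComponent a p = 0) :
    p ∈ idealOfVars σ ℂ ^ (a + 1) := by
  simpa [h] using sub_homogeneousComponent_mem hp

theorem homogeneousComponent_eq_of_sub_mem {p q : MvPolynomial σ ℂ} {a : ℕ}
    (h : p - q ∈ idealOfVars σ ℂ ^ (a + 1)) :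
    homogeneousComponent a p = homogeneousComponent a q := by
  have := homogeneousComponent_eq_zero_of_mem_pow h (Nat.lt_succ_self a)
  rwa [map_sub, sub_eq_zero] at this

theorem mul_sub_mul_homogeneousComponent_mem {p q : MvPolynomial σ ℂ} {a b : ℕ}
    (hp : p ∈ idealOfVars σ ℂ ^ a) (hq : q ∈ idealOfVars σ ℂ ^ b) :
    p * q - homogeneousComponent a p * homogeneousComponent b q
      ∈ idealOfVars σ ℂ ^ (a + b + 1) := by
  have h1 := Ideal.mul_mem_mul (sub_homogeneousComponent_mem hp) hq
  have h2 := Ideal.mul_mem_mul (mem_pow_of_isHomogeneous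
    (homogeneousComponent_isHomogeneous a p) le_rfl) (sub_homogeneousComponent_mem hq)
  rw [← pow_add] at h1 h2
  rw [show a + 1 + b = a + b + 1 by ring] at h1
  rw [← add_assoc] at h2
  convert Ideal.add_mem _ h1 h2 using 1
  ring

/-- The leading form of a product is the product of the leading forms. -/
theorem homogeneousComponent_mul {p q : MvPolynomial σ ℂ} {a b : ℕ}
    (hp : p ∈ idealOfVars σ ℂ ^ a) (hq : q ∈ idealOfVars σ ℂ ^ b) :
    homogeneousComponent (a + b) (p * q)
      = homogeneousComponent a p * homogeneousComponent b q := by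
  rw [homogeneousComponent_eq_of_sub_mem (mul_sub_mul_homogeneousComponent_mem hp hq),
    homogeneousComponent_eq_self]
  exact (homogeneousComponent_isHomogeneous a p).mul (homogeneousComponent_isHomogeneous b q)

theorem prod_mem_pow_and_homogeneousComponent_prod {ι : Type*} (T : Finset ι)
    (p : ι → MvPolynomial σ ℂ) (hp : ∀ i ∈ T, p i ∈ idealOfVars σ ℂ) :
    ∏ i ∈ T, p i ∈ idealOfVars σ ℂ ^ T.card ∧
      homogeneousComponent T.card (∏ i ∈ T, p i) = ∏ i ∈ T, homogeneousComponent 1 (p i) := by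
  classical
  induction T using Finset.induction_on with
  | empty => simp [homogeneousComponent_zero]
  | insert i T hi ih =>
    obtain ⟨h1, h2⟩ := ih fun j hj => hp j (Finset.mem_insert_of_mem hj)
    have h3 : p i ∈ idealOfVars σ ℂ ^ 1 := by
      simpa using hp i (Finset.mem_insert_self i T)
    rw [Finset.prod_insert hi, Finset.prod_insert hi, Finset.card_insert_of_notMem hi, add_comm,
      ← h2, homogeneousComponent_mul h3 h1, pow_add]
    exact ⟨Ideal.mul_mem_mul h3 h1, rfl⟩

theorem pderiv_homogeneousComponent (i : σ) (n : ℕ) (p : MvPolynomial σ ℂ) :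
    pderiv i (homogeneousComponent (n + 1) p) = homogeneousComponent n (pderiv i p) := by
  classical
  ext x
  rw [coeff_homogeneousComponent, coeff_pderiv, coeff_pderiv, coeff_homogeneousComponent]
  simp [map_add]

theorem pderiv_mem_pow {i : σ} {n : ℕ} {p : MvPolynomial σ ℂ}
    (hp : p ∈ idealOfVars σ ℂ ^ (n + 1)) : pderiv i p ∈ idealOfVars σ ℂ ^ n := by
  classical
  rw [mem_pow_idealOfVars_iff'] at hp ⊢
  intro x hx
  rw [coeff_pderiv, hp _ (by simpa [map_add] using hx), zero_mul]

end LeadingForms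

/-! ### Truncation of polynomials in two variables -/

section Truncation

/-- The space of polynomials in two variables of degree less than `k`. -/
noncomputable def polysDegreeLT (k : ℕ) : Submodule ℂ (MvPolynomial (Fin 2) ℂ) :=
  restrictSupport ℂ {x | x.degree < k}

theorem mem_polysDegreeLT {k : ℕ} {p : MvPolynomial (Fin 2) ℂ} :
    p ∈ polysDegreeLT k ↔ ∀ x, k ≤ x.degree → p.coeff x = 0 := by
  rw [polysDegreeLT, mem_restrictSupport_iff]
  constructor
  · intro h x hx
    by_contra h0
    exact absurd (h (mem_support_iff.2 h0)) (by simpa using hx)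
  · intro h x hx
    by_contra h0
    exact mem_support_iff.1 hx (h x (by simpa using h0))

theorem ncard_degree_eq (k : ℕ) : {x : Fin 2 →₀ ℕ | x.degree = k}.ncard = k + 1 := by
  have : {x : Fin 2 →₀ ℕ | x.degree = k} =
      (Finsupp.equivFunOnFinite.symm ∘ (finTwoArrowEquiv ℕ).symm) ''
        ((Finset.HasAntidiagonal.antidiagonal k : Finset (ℕ × ℕ)) : Set (ℕ × ℕ)) := by
    ext x
    simp only [Set.mem_ofPred_eq, Set.mem_image, Finset.mem_coe, Finset.HasAntidiagonal.mem_antidiagonal]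
    constructor
    · intro h
      refine ⟨(x 0, x 1), by simpa [Finsupp.degree_eq_sum] using h, ?_⟩
      ext i
      fin_cases i <;> simp
    · rintro ⟨y, hy, rfl⟩
      simpa [Finsupp.degree_eq_sum] using hy
  rw [this, Set.ncard_image_of_injective _ (by
    exact Finsupp.equivFunOnFinite.symm.injective.comp (finTwoArrowEquiv ℕ).symm.injective),
    Set.ncard_coe_finset, Finset.Nat.card_antidiagonal]

theorem finite_degree_eq (k : ℕ) : {x : Fin 2 →₀ ℕ | x.degree = k}.Finite :=
  Set.finite_of_ncard_ne_zero (by rw [ncard_degree_eq]; omega)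

theorem finite_degree_lt (k : ℕ) : {x : Fin 2 →₀ ℕ | x.degree < k}.Finite := by
  refine ((Set.finite_Iio k).biUnion fun i _ => finite_degree_eq i).subset ?_
  intro x hx
  simpa using hx

theorem ncard_degree_lt (k : ℕ) : 2 * {x : Fin 2 →₀ ℕ | x.degree < k}.ncard = k * (k + 1) := by
  induction k with
  | zero => simp
  | succ k ih =>
    have : {x : Fin 2 →₀ ℕ | x.degree < k + 1} =
        {x | x.degree < k} ∪ {x | x.degree = k} := by
      ext x
      simp only [Set.mem_ofPred_eq, Set.mem_union]
      omega
    rw [this, Set.ncard_union_eq (by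
      rw [Set.disjoint_left]; intro x hx hx'; simp at hx hx'; omega)
      (finite_degree_lt k) (finite_degree_eq k), mul_add, ih, ncard_degree_eq]
    ring

theorem finrank_restrictSupport (s : Set (Fin 2 →₀ ℕ)) :
    Module.finrank ℂ (restrictSupport ℂ s) = s.ncard := by
  rw [Module.finrank_eq_nat_card_basis (basisRestrictSupport ℂ s), Nat.card_coe_set_eq]

theorem two_mul_finrank_polysDegreeLT (k : ℕ) :
    2 * Module.finrank ℂ (polysDegreeLT k) = k * (k + 1) := by
  rw [polysDegreeLT, finrank_restrictSupport, ncard_degree_lt]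

instance (k : ℕ) : Module.Finite ℂ (polysDegreeLT k) :=
  have := (finite_degree_lt k).to_subtype
  Module.Finite.of_basis (basisRestrictSupport ℂ _)

theorem finrank_homogeneousSubmodule_two (k : ℕ) :
    Module.finrank ℂ (homogeneousSubmodule (Fin 2) ℂ k) = k + 1 := by
  rw [homogeneousSubmodule_eq_finsupp_supported, ← ncard_degree_eq k]
  exact finrank_restrictSupport _

instance (k : ℕ) : Module.Finite ℂ (homogeneousSubmodule (Fin 2) ℂ k) :=
  Module.finite_of_finrank_pos (by rw [finrank_homogeneousSubmodule_two]; omega)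

/-- The part of degree less than `k` of a polynomial represents it modulo terms of order `k`. -/
theorem exists_mem_polysDegreeLT_sub_mem (k : ℕ) (p : MvPolynomial (Fin 2) ℂ) :
    ∃ q ∈ polysDegreeLT k, p - q ∈ idealOfVars (Fin 2) ℂ ^ k := by
  classical
  induction k with
  | zero => exact ⟨0, zero_mem _, by simp⟩
  | succ k ih =>
    obtain ⟨q, hq, hpq⟩ := ih
    refine ⟨q + homogeneousComponent k (p - q), ?_, ?_⟩
    · rw [mem_polysDegreeLT] at hq ⊢
      intro x hx
      rw [coeff_add, hq x (by omega), coeff_homogeneousComponent, if_neg (by omega), zero_add]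
    · rw [← sub_sub]
      exact sub_homogeneousComponent_mem hpq

theorem eq_zero_of_mem_polysDegreeLT_of_mem_pow {k : ℕ} {p : MvPolynomial (Fin 2) ℂ}
    (hp : p ∈ polysDegreeLT k) (hp' : p ∈ idealOfVars (Fin 2) ℂ ^ k) : p = 0 := by
  ext x
  rw [coeff_zero]
  rcases lt_or_ge x.degree k with h | h
  · exact (mem_pow_idealOfVars_iff' k p).1 hp' x h
  · exact mem_polysDegreeLT.1 hp x h

/-- Truncation identifies `ℂ[s, t] / (s, t)^k` with the polynomials of degree less than `k`. -/
noncomputable def polysDegreeLTEquivQuotient (k : ℕ) :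
    polysDegreeLT k ≃ₗ[ℂ] (MvPolynomial (Fin 2) ℂ ⧸ idealOfVars (Fin 2) ℂ ^ k) :=
  LinearEquiv.ofBijective
    ((Ideal.Quotient.mkₐ ℂ (idealOfVars (Fin 2) ℂ ^ k)).toLinearMap ∘ₗ (polysDegreeLT k).subtype)
    (by
      constructor
      · rw [← LinearMap.ker_eq_bot, LinearMap.ker_eq_bot']
        rintro ⟨p, hp⟩ h
        have h' : p ∈ idealOfVars (Fin 2) ℂ ^ k := Ideal.Quotient.eq_zero_iff_mem.1 h
        exact Subtype.ext (eq_zero_of_mem_polysDegreeLT_of_mem_pow hp h')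
      · intro y
        obtain ⟨p, rfl⟩ := Ideal.Quotient.mk_surjective y
        obtain ⟨q, hq, hpq⟩ := exists_mem_polysDegreeLT_sub_mem k p
        exact ⟨⟨q, hq⟩, ((Ideal.Quotient.eq).2 hpq).symm⟩)

end Truncation

/-! ### Relations between the partial derivatives of a product of linear forms -/

section LinearForms

/-- The binary linear form `a s + b t`. -/
noncomputable def binaryLinearForm (a b : ℂ) : MvPolynomial (Fin 2) ℂ := C a * X 0 + C b * X 1

theorem isHomogeneous_binaryLinearForm (a b : ℂ) : (binaryLinearForm a b).IsHomogeneous 1 :=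
  (isHomogeneous_C_mul_X a 0).add (isHomogeneous_C_mul_X b 1)

@[simp] theorem pderiv_zero_binaryLinearForm (a b : ℂ) :
    pderiv 0 (binaryLinearForm a b) = C a := by
  simp [binaryLinearForm]

@[simp] theorem pderiv_one_binaryLinearForm (a b : ℂ) :
    pderiv 1 (binaryLinearForm a b) = C b := by
  simp [binaryLinearForm]

theorem binaryLinearForm_injective {a b a' b' : ℂ}
    (h : binaryLinearForm a b = binaryLinearForm a' b') : a = a' ∧ b = b' := by
  refine ⟨?_, ?_⟩
  · simpa using congrArg (pderiv 0) h
  · simpa using congrArg (pderiv 1) h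

theorem binaryLinearForm_ne_zero {a b : ℂ} (h : a ≠ 0 ∨ b ≠ 0) : binaryLinearForm a b ≠ 0 := by
  intro h0
  obtain ⟨h1, h2⟩ := binaryLinearForm_injective (a' := 0) (b' := 0)
    (h0.trans (by simp [binaryLinearForm]))
  tauto

theorem prime_binaryLinearForm {a b : ℂ} (h : a ≠ 0 ∨ b ≠ 0) : Prime (binaryLinearForm a b) := by
  rw [← irreducible_iff_prime]
  have h0 := binaryLinearForm_ne_zero h
  refine irreducible_of_totalDegree_eq_one
    ((isHomogeneous_binaryLinearForm a b).totalDegree h0) fun x hx => ?_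
  rw [isUnit_iff_ne_zero]
  rintro rfl
  exact h0 (by ext i; simpa using hx i)

theorem not_dvd_binaryLinearForm {a b a' b' : ℂ} (h : a * b' - b * a' ≠ 0) :
    ¬ binaryLinearForm a b ∣ binaryLinearForm a' b' := by
  rintro ⟨c, hc⟩
  have h0 : binaryLinearForm a b ≠ 0 := binaryLinearForm_ne_zero (by
    by_contra! hh; apply h; rw [hh.1, hh.2]; ring)
  have h0' : binaryLinearForm a' b' ≠ 0 := binaryLinearForm_ne_zero (by
    by_contra! hh; apply h; rw [hh.1, hh.2]; ring)
  have hc0 : c ≠ 0 := by rintro rfl; exact h0' (by simpa using hc)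
  have hd := congrArg totalDegree hc
  rw [totalDegree_mul_of_isDomain h0 hc0, (isHomogeneous_binaryLinearForm _ _).totalDegree h0,
    (isHomogeneous_binaryLinearForm _ _).totalDegree h0'] at hd
  obtain ⟨k, rfl⟩ : ∃ k, c = C k := ⟨_, totalDegree_eq_zero_iff_eq_C.1 (by omega)⟩
  have : binaryLinearForm a b * C k = binaryLinearForm (a * k) (b * k) := by
    simp only [binaryLinearForm, C_mul]; ring
  rw [this] at hc
  obtain ⟨rfl, rfl⟩ := binaryLinearForm_injective hc
  apply h; ring

/-- The partial derivatives of the binary form `G` (meant to have degree `r ≥ 2`) satisfy no relation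
`A G_s + B G_t = 0` with nontrivial coefficients `A`, `B` of degree at most `r - 2`. -/
def HasIndependentPartials (r : ℕ) (G : MvPolynomial (Fin 2) ℂ) : Prop :=
  ∀ A B : MvPolynomial (Fin 2) ℂ, A.totalDegree ≤ r - 2 → B.totalDegree ≤ r - 2 →
    A * pderiv 0 G + B * pderiv 1 G = 0 → A = 0 ∧ B = 0

/-- For a product `G` of pairwise non-proportional linear forms, a relation `A G_s + B G_t = 0`
makes every factor divide `t A - s B`; if the degree of `A` and `B` is low, this forces
`t A = s B`, and Euler's formula finishes. -/
theorem hasIndependentPartials_prod {ι : Type*} (T : Finset ι) (hT : 2 ≤ T.card) (k : ℂ)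
    (hk : k ≠ 0) (a b : ι → ℂ)
    (hab : ∀ i ∈ T, ∀ j ∈ T, i ≠ j → a i * b j - b i * a j ≠ 0) :
    HasIndependentPartials T.card (C k * ∏ i ∈ T, binaryLinearForm (a i) (b i)) := by
  classical
  intro A B hA hB hAB
  set G := ∏ i ∈ T, binaryLinearForm (a i) (b i) with hG
  have hne : ∀ i ∈ T, a i ≠ 0 ∨ b i ≠ 0 := by
    intro i hi
    obtain ⟨j, hj, hij⟩ := Finset.exists_mem_ne (s := T) (by omega) i
    by_contra! hh
    exact hab i hi j hj hij.symm (by rw [hh.1, hh.2]; ring)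
  have hG0 : G ≠ 0 := Finset.prod_ne_zero_iff.2 fun i hi => binaryLinearForm_ne_zero (hne i hi)
  have hGhom : G.IsHomogeneous T.card := by
    have := IsHomogeneous.prod T (fun i => binaryLinearForm (a i) (b i)) (fun _ => 1)
      fun i _ => isHomogeneous_binaryLinearForm _ _
    simpa using this
  have hAB' : A * pderiv 0 G + B * pderiv 1 G = 0 := by
    have h1 : C k * (A * pderiv 0 G + B * pderiv 1 G) = 0 := by
      rw [← hAB]; simp only [pderiv_C_mul]; ring
    simpa [hk] using h1
  have hdvd : ∀ i ∈ T, binaryLinearForm (a i) (b i) ∣ X 1 * A - X 0 * B := by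
    intro i hi
    set L := binaryLinearForm (a i) (b i) with hL
    have hsplit : G = L * ∏ j ∈ T.erase i, binaryLinearForm (a j) (b j) :=
      (Finset.mul_prod_erase T _ hi).symm
    set P := ∏ j ∈ T.erase i, binaryLinearForm (a j) (b j) with hP
    have hprime := prime_binaryLinearForm (hne i hi)
    have h1 : L ∣ (C (a i) * A + C (b i) * B) * P := by
      refine ⟨-(A * pderiv 0 P + B * pderiv 1 P), ?_⟩
      rw [hsplit] at hAB'
      simp only [Derivation.leibniz, smul_eq_mul, hL, pderiv_zero_binaryLinearForm,
        pderiv_one_binaryLinearForm] at hAB'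
      linear_combination hAB'
    have h2 : L ∣ C (a i) * A + C (b i) * B := by
      refine (hprime.dvd_or_dvd h1).resolve_right fun h => ?_
      obtain ⟨j, hj, hdj⟩ := (hprime.dvd_finsetProd_iff _).1 h
      rw [Finset.mem_erase] at hj
      exact not_dvd_binaryLinearForm (hab i hi j hj.2 hj.1.symm) hdj
    have hLe : L = C (a i) * X 0 + C (b i) * X 1 := rfl
    rcases hne i hi with h | h
    · have h3 : L ∣ C (a i) * (X 1 * A - X 0 * B) := by
        have : C (a i) * (X 1 * A - X 0 * B) = X 1 * (C (a i) * A + C (b i) * B) - B * L := by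
          rw [hLe]; ring
        rw [this]
        exact dvd_sub (h2.mul_left _) (dvd_mul_left _ _)
      exact (((isUnit_iff_ne_zero.2 h).map (C (σ := Fin 2))).dvd_mul_left).1 h3
    · have h3 : L ∣ C (b i) * (X 1 * A - X 0 * B) := by
        have : C (b i) * (X 1 * A - X 0 * B) = A * L - X 0 * (C (a i) * A + C (b i) * B) := by
          rw [hLe]; ring
        rw [this]
        exact dvd_sub (dvd_mul_left _ _) (h2.mul_left _)
      exact (((isUnit_iff_ne_zero.2 h).map (C (σ := Fin 2))).dvd_mul_left).1 h3
  have hGdvd : G ∣ X 1 * A - X 0 * B := by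
    refine Finset.prod_dvd_of_isRelPrime ?_ hdvd
    intro i hi j hj hij
    exact ((prime_binaryLinearForm (hne i hi)).irreducible.isRelPrime_iff_not_dvd).2
      (not_dvd_binaryLinearForm (hab i hi j hj hij))
  have hzero : X 1 * A - X 0 * B = 0 := by
    obtain ⟨D, hD⟩ := hGdvd
    by_contra hne0
    have hD0 : D ≠ 0 := by rintro rfl; exact hne0 (by simpa using hD)
    have hdeg := congrArg totalDegree hD
    rw [totalDegree_mul_of_isDomain hG0 hD0, hGhom.totalDegree hG0] at hdeg
    have h1 : (X 1 * A - X 0 * B).totalDegree ≤ T.card - 1 := by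
      refine (totalDegree_sub _ _).trans (max_le ?_ ?_) <;>
      · refine (totalDegree_mul _ _).trans ?_
        rw [totalDegree_X]
        omega
    omega
  have hEuler := hGhom.sum_X_mul_pderiv
  rw [Fin.sum_univ_two, nsmul_eq_mul] at hEuler
  have hcard : (T.card : MvPolynomial (Fin 2) ℂ) ≠ 0 := by
    rw [Nat.cast_ne_zero]; omega
  constructor
  · have : (T.card * G) * A = 0 := by
      linear_combination (-A) * hEuler + X 0 * hAB' + pderiv 1 G * hzero
    simpa [hcard, hG0] using this
  · have : (T.card * G) * B = 0 := by
      linear_combination (-B) * hEuler + X 1 * hAB' - pderiv 0 G * hzero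
    simpa [hcard, hG0] using this

end LinearForms

/-! ### The Jacobian ideal of a plane curve singularity -/

section LocalAlgebra

variable {r : ℕ} {F : MvPolynomial (Fin 2) ℂ}

/-- The ideal generated by the partial derivatives of `F` and by all terms of order `2 r - 3`. For
an `F` of order `r` with reduced tangent cone the second part is superfluous locally at the
origin. -/
noncomputable def truncatedJacobian (r : ℕ) (F : MvPolynomial (Fin 2) ℂ) :
    Ideal (MvPolynomial (Fin 2) ℂ) :=
  Ideal.span {pderiv 0 F, pderiv 1 F} ⊔ idealOfVars (Fin 2) ℂ ^ (2 * r - 3)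

theorem pow_le_truncatedJacobian : idealOfVars (Fin 2) ℂ ^ (2 * r - 3) ≤ truncatedJacobian r F :=
  le_sup_right

theorem pderiv_zero_mem_truncatedJacobian : pderiv 0 F ∈ truncatedJacobian r F :=
  Ideal.mem_sup_left (Ideal.subset_span (by simp))

theorem pderiv_one_mem_truncatedJacobian : pderiv 1 F ∈ truncatedJacobian r F :=
  Ideal.mem_sup_left (Ideal.subset_span (by simp))

theorem mul_pderiv_mem_pow {i : Fin 2} (hr : 2 ≤ r) (hF : F ∈ idealOfVars (Fin 2) ℂ ^ r)
    {A : MvPolynomial (Fin 2) ℂ} {e : ℕ} (hA : A ∈ idealOfVars (Fin 2) ℂ ^ e) :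
    A * pderiv i F ∈ idealOfVars (Fin 2) ℂ ^ (e + (r - 1)) ∧
      homogeneousComponent (e + (r - 1)) (A * pderiv i F) =
        homogeneousComponent e A * pderiv i (homogeneousComponent r F) := by
  obtain ⟨k, rfl⟩ : ∃ k, r = k + 1 := ⟨r - 1, by omega⟩
  have h := pderiv_mem_pow (i := i) hF
  rw [Nat.add_sub_cancel, homogeneousComponent_mul hA h, pderiv_homogeneousComponent, pow_add]
  exact ⟨Ideal.mul_mem_mul hA h, rfl⟩

/-- `A F_s + B F_t` with `A`, `B` of degree less than `r - 2` has order less than `2 r - 3`: look at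
its lowest-order terms. -/
theorem eq_zero_of_mul_pderiv_mem_pow (hr : 2 ≤ r) (hF : F ∈ idealOfVars (Fin 2) ℂ ^ r)
    (hG : HasIndependentPartials r (homogeneousComponent r F))
    {A B : MvPolynomial (Fin 2) ℂ} (hA : A ∈ polysDegreeLT (r - 2)) (hB : B ∈ polysDegreeLT (r - 2))
    (h : A * pderiv 0 F + B * pderiv 1 F ∈ idealOfVars (Fin 2) ℂ ^ (2 * r - 3)) :
    A = 0 ∧ B = 0 := by
  have key : ∀ e ≤ r - 2, A ∈ idealOfVars (Fin 2) ℂ ^ e ∧ B ∈ idealOfVars (Fin 2) ℂ ^ e := by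
    intro e
    induction e with
    | zero => simp
    | succ e ih =>
      intro he
      obtain ⟨hA', hB'⟩ := ih (by omega)
      have h1 := homogeneousComponent_eq_zero_of_mem_pow h (n := e + (r - 1)) (by omega)
      rw [map_add, (mul_pderiv_mem_pow hr hF hA').2, (mul_pderiv_mem_pow hr hF hB').2] at h1
      obtain ⟨h2, h3⟩ := hG _ _
        ((homogeneousComponent_isHomogeneous e A).totalDegree_le.trans (by omega))
        ((homogeneousComponent_isHomogeneous e B).totalDegree_le.trans (by omega)) h1
      exact ⟨mem_pow_succ_of_homogeneousComponent_eq_zero hA' h2,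
        mem_pow_succ_of_homogeneousComponent_eq_zero hB' h3⟩
  obtain ⟨h1, h2⟩ := key _ le_rfl
  exact ⟨eq_zero_of_mem_polysDegreeLT_of_mem_pow hA h1,
    eq_zero_of_mem_polysDegreeLT_of_mem_pow hB h2⟩

/-- The linear map `(A, B) ↦ A F_s + B F_t`. -/
noncomputable def combinePartials (F : MvPolynomial (Fin 2) ℂ) :
    MvPolynomial (Fin 2) ℂ × MvPolynomial (Fin 2) ℂ →ₗ[ℂ] MvPolynomial (Fin 2) ℂ :=
  (LinearMap.mulRight ℂ (pderiv 0 F)).coprod (LinearMap.mulRight ℂ (pderiv 1 F))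

/-- The local quotient has dimension `(r - 1)²`: modulo terms of order `2 r - 3`, the ideal consists
of the `A F_s + B F_t` with `A` and `B` of degree less than `r - 2`, each represented once. -/
theorem finrank_quotient_truncatedJacobian (hr : 2 ≤ r) (hF : F ∈ idealOfVars (Fin 2) ℂ ^ r)
    (hG : HasIndependentPartials r (homogeneousComponent r F)) :
    Module.Finite ℂ (MvPolynomial (Fin 2) ℂ ⧸ truncatedJacobian r F) ∧
    Module.finrank ℂ (MvPolynomial (Fin 2) ℂ ⧸ truncatedJacobian r F) = (r - 1) ^ 2 := by
  set I := idealOfVars (Fin 2) ℂ ^ (2 * r - 3) with hI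
  have hfin : Module.Finite ℂ (MvPolynomial (Fin 2) ℂ ⧸ I) :=
    Module.Finite.equiv (polysDegreeLTEquivQuotient (2 * r - 3))
  let ρ : (MvPolynomial (Fin 2) ℂ ⧸ I) →ₗ[ℂ] (MvPolynomial (Fin 2) ℂ ⧸ truncatedJacobian r F) :=
    (Ideal.Quotient.factorₐ ℂ (pow_le_truncatedJacobian (r := r) (F := F))).toLinearMap
  have hρ : Function.Surjective ρ :=
    Ideal.Quotient.factor_surjective (pow_le_truncatedJacobian (r := r) (F := F))
  let Λ : (polysDegreeLT (r - 2) × polysDegreeLT (r - 2)) →ₗ[ℂ] (MvPolynomial (Fin 2) ℂ ⧸ I) :=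
    (Ideal.Quotient.mkₐ ℂ I).toLinearMap ∘ₗ combinePartials F ∘ₗ
      (polysDegreeLT (r - 2)).subtype.prodMap (polysDegreeLT (r - 2)).subtype
  have hΛ : Function.Injective Λ := by
    rw [← LinearMap.ker_eq_bot, LinearMap.ker_eq_bot']
    rintro ⟨⟨A, hA⟩, ⟨B, hB⟩⟩ h
    have h' : A * pderiv 0 F + B * pderiv 1 F ∈ I := Ideal.Quotient.eq_zero_iff_mem.1 h
    obtain ⟨rfl, rfl⟩ := eq_zero_of_mul_pderiv_mem_pow hr hF hG hA hB h'
    rfl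
  have hker : LinearMap.ker ρ = LinearMap.range Λ := by
    apply le_antisymm
    · intro y hy
      obtain ⟨p, rfl⟩ := Ideal.Quotient.mk_surjective y
      have hp : p ∈ truncatedJacobian r F := Ideal.Quotient.eq_zero_iff_mem.1 hy
      obtain ⟨q, hq, z, hz, rfl⟩ := Submodule.mem_sup.1 hp
      obtain ⟨A, B, rfl⟩ := Ideal.mem_span_pair.1 hq
      obtain ⟨A', hA', hA⟩ := exists_mem_polysDegreeLT_sub_mem (r - 2) A
      obtain ⟨B', hB', hB⟩ := exists_mem_polysDegreeLT_sub_mem (r - 2) B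
      refine ⟨⟨⟨A', hA'⟩, ⟨B', hB'⟩⟩, (Ideal.Quotient.eq (I := I)).2 ?_⟩
      have h1 := (mul_pderiv_mem_pow (i := 0) hr hF hA).1
      have h2 := (mul_pderiv_mem_pow (i := 1) hr hF hB).1
      rw [show r - 2 + (r - 1) = 2 * r - 3 by omega] at h1 h2
      have h3 := I.neg_mem (I.add_mem (I.add_mem h1 h2) hz)
      convert h3 using 1
      change A' * pderiv 0 F + B' * pderiv 1 F - _ = _
      ring
    · rintro _ ⟨⟨⟨A, hA⟩, ⟨B, hB⟩⟩, rfl⟩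
      refine Ideal.Quotient.eq_zero_iff_mem.2 ?_
      exact Ideal.add_mem _ (Ideal.mul_mem_left _ _ pderiv_zero_mem_truncatedJacobian)
        (Ideal.mul_mem_left _ _ pderiv_one_mem_truncatedJacobian)
  refine ⟨Module.Finite.of_surjective ρ hρ, ?_⟩
  have h1 := LinearMap.finrank_range_add_finrank_ker ρ
  rw [LinearMap.range_eq_top.2 hρ, finrank_top, hker, LinearMap.finrank_range_of_inj hΛ,
    Module.finrank_prod, ← (polysDegreeLTEquivQuotient (2 * r - 3)).finrank_eq] at h1
  have h2 := two_mul_finrank_polysDegreeLT (r - 2)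
  have h3 := two_mul_finrank_polysDegreeLT (2 * r - 3)
  obtain ⟨k, rfl⟩ : ∃ k, r = k + 2 := ⟨r - 2, by omega⟩
  rw [show 2 * (k + 2) - 3 = 2 * k + 1 by omega] at h1 h3
  rw [Nat.add_sub_cancel] at h1 h2
  rw [show k + 2 - 1 = k + 1 by omega]
  nlinarith

/-- By a dimension count in degree `2 r - 3`, the partial derivatives generate everything of that
order modulo higher order. -/
theorem pow_le_span_pderiv_sup (hr : 2 ≤ r) (hF : F ∈ idealOfVars (Fin 2) ℂ ^ r)
    (hG : HasIndependentPartials r (homogeneousComponent r F)) :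
    idealOfVars (Fin 2) ℂ ^ (2 * r - 3) ≤ Ideal.span {pderiv 0 F, pderiv 1 F} ⊔
      idealOfVars (Fin 2) ℂ • idealOfVars (Fin 2) ℂ ^ (2 * r - 3) := by
  set G := homogeneousComponent r F with hGdef
  have hGhom : G.IsHomogeneous r := homogeneousComponent_isHomogeneous r F
  let H := homogeneousSubmodule (Fin 2) ℂ (r - 2)
  let Θ : (H × H) →ₗ[ℂ] homogeneousSubmodule (Fin 2) ℂ (2 * r - 3) :=
    LinearMap.codRestrict _ (combinePartials G ∘ₗ H.subtype.prodMap H.subtype) (by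
      rintro ⟨⟨A, hA⟩, ⟨B, hB⟩⟩
      change (A * pderiv 0 G + B * pderiv 1 G).IsHomogeneous _
      have h1 := IsHomogeneous.mul hA (hGhom.pderiv (i := 0))
      have h2 := IsHomogeneous.mul hB (hGhom.pderiv (i := 1))
      rw [show r - 2 + (r - 1) = 2 * r - 3 by omega] at h1 h2
      exact h1.add h2)
  have hΘ : Function.Injective Θ := by
    rw [← LinearMap.ker_eq_bot, LinearMap.ker_eq_bot']
    rintro ⟨⟨A, hA⟩, ⟨B, hB⟩⟩ h
    have h' : A * pderiv 0 G + B * pderiv 1 G = 0 := congrArg Subtype.val h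
    obtain ⟨rfl, rfl⟩ := hG A B (IsHomogeneous.totalDegree_le hA) (IsHomogeneous.totalDegree_le hB) h'
    rfl
  have hΘs : Function.Surjective Θ := by
    refine (LinearMap.injective_iff_surjective_of_finrank_eq_finrank ?_).1 hΘ
    rw [Module.finrank_prod, finrank_homogeneousSubmodule_two, finrank_homogeneousSubmodule_two]
    omega
  intro y hy
  obtain ⟨⟨⟨A, hA⟩, ⟨B, hB⟩⟩, hAB⟩ :=
    hΘs ⟨homogeneousComponent (2 * r - 3) y, homogeneousComponent_isHomogeneous _ y⟩
  have hAB' : A * pderiv 0 G + B * pderiv 1 G = homogeneousComponent (2 * r - 3) y :=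
    congrArg Subtype.val hAB
  have hA1 := mul_pderiv_mem_pow (i := 0) hr hF (mem_pow_of_isHomogeneous hA le_rfl)
  have hB1 := mul_pderiv_mem_pow (i := 1) hr hF (mem_pow_of_isHomogeneous hB le_rfl)
  rw [show r - 2 + (r - 1) = 2 * r - 3 by omega, homogeneousComponent_eq_self hA] at hA1
  rw [show r - 2 + (r - 1) = 2 * r - 3 by omega, homogeneousComponent_eq_self hB] at hB1
  have h1 : y - (A * pderiv 0 F + B * pderiv 1 F) ∈ idealOfVars (Fin 2) ℂ ^ (2 * r - 3 + 1) := by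
    refine mem_pow_succ_of_homogeneousComponent_eq_zero
      (Ideal.sub_mem _ hy (Ideal.add_mem _ hA1.1 hB1.1)) ?_
    rw [map_sub, map_add, hA1.2, hB1.2, ← hAB', sub_self]
  rw [pow_succ', ← smul_eq_mul] at h1
  rw [← add_sub_cancel (A * pderiv 0 F + B * pderiv 1 F) y]
  exact Submodule.add_mem_sup (Ideal.mem_span_pair.2 ⟨A, B, rfl⟩) h1

/-- Nakayama's lemma: locally at the origin the partial derivatives generate the truncated Jacobian
ideal. -/
theorem exists_mul_truncatedJacobian_le (hr : 2 ≤ r) (hF : F ∈ idealOfVars (Fin 2) ℂ ^ r)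
    (hG : HasIndependentPartials r (homogeneousComponent r F)) :
    ∃ h : MvPolynomial (Fin 2) ℂ, constantCoeff h = 1 ∧
      ∀ g ∈ truncatedJacobian r F, h * g ∈ Ideal.span {pderiv 0 F, pderiv 1 F} := by
  obtain ⟨h, hh, hle⟩ := Submodule.exists_sub_one_mem_and_smul_le_of_fg_of_le_sup
    ((idealOfVars_fg (Fin 2) ℂ).pow (n := 2 * r - 3)) le_rfl (pow_le_span_pderiv_sup hr hF hG)
  refine ⟨h, ?_, ?_⟩
  · have h1 := (mem_pow_idealOfVars_iff' 1 (h - 1)).1 (by simpa using hh) 0 (by simp)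
    rw [← constantCoeff_eq, map_sub, map_one, sub_eq_zero] at h1
    exact h1
  · intro g hg
    obtain ⟨q, hq, z, hz, rfl⟩ := Submodule.mem_sup.1 hg
    rw [mul_add]
    exact Ideal.add_mem _ (Ideal.mul_mem_left _ _ hq)
      (hle (Submodule.smul_mem_pointwise_smul z h _ hz))

/-- By Euler's formula for the leading form, `F` lies in the ideal of its partial derivatives up to
terms of order `r + 1`; for `r ≤ 4` these have order at least `2 r - 3`. -/
theorem self_mem_truncatedJacobian (hr : 2 ≤ r) (hr4 : r ≤ 4)
    (hF : F ∈ idealOfVars (Fin 2) ℂ ^ r) : F ∈ truncatedJacobian r F := by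
  set I := idealOfVars (Fin 2) ℂ with hI
  have hX : ∀ i : Fin 2, (X i : MvPolynomial (Fin 2) ℂ) ∈ I ^ 1 := fun i =>
    mem_pow_of_isHomogeneous (isHomogeneous_X ℂ i) le_rfl
  have h0 := mul_pderiv_mem_pow (i := 0) hr hF (hX 0)
  have h1 := mul_pderiv_mem_pow (i := 1) hr hF (hX 1)
  rw [show 1 + (r - 1) = r by omega, homogeneousComponent_eq_self (isHomogeneous_X ℂ _)] at h0 h1
  have hEuler := (homogeneousComponent_isHomogeneous r F).sum_X_mul_pderiv
  rw [Fin.sum_univ_two, nsmul_eq_mul] at hEuler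
  have hmem : (r : MvPolynomial (Fin 2) ℂ) * F - (X 0 * pderiv 0 F + X 1 * pderiv 1 F) ∈
      I ^ (r + 1) := by
    refine mem_pow_succ_of_homogeneousComponent_eq_zero
      (Ideal.sub_mem _ (Ideal.mul_mem_left _ _ hF) (Ideal.add_mem _ h0.1 h1.1)) ?_
    rw [map_sub, map_add, h0.2, h1.2, hEuler, sub_eq_zero, ← nsmul_eq_mul, ← nsmul_eq_mul,
      map_nsmul]
  have h2 : (r : MvPolynomial (Fin 2) ℂ) * F ∈ truncatedJacobian r F := by
    rw [← sub_add_cancel ((r : MvPolynomial (Fin 2) ℂ) * F)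
      (X 0 * pderiv 0 F + X 1 * pderiv 1 F)]
    exact Ideal.add_mem _ (pow_le_truncatedJacobian (Ideal.pow_le_pow_right (by omega) hmem))
      (Ideal.add_mem _ (Ideal.mul_mem_left _ _ pderiv_zero_mem_truncatedJacobian)
        (Ideal.mul_mem_left _ _ pderiv_one_mem_truncatedJacobian))
  have h3 : F = C ((r : ℂ)⁻¹) * ((r : MvPolynomial (Fin 2) ℂ) * F) := by
    rw [← mul_assoc, ← C_eq_coe_nat, ← C_mul, inv_mul_cancel₀ (by rw [Nat.cast_ne_zero]; omega),
      C_1, one_mul]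
  have h4 := Ideal.mul_mem_left _ (C ((r : ℂ)⁻¹)) h2
  rwa [← h3] at h4

end LocalAlgebra

/-! ### Affine charts of the projective plane -/

section Chart

theorem eval_smul_of_isHomogeneous {g : PlaneRing} {n : ℕ} (hg : g.IsHomogeneous n) (z : ℂ)
    (x : Fin 3 → ℂ) : eval (z • x) g = z ^ n * eval x g := by
  rw [eval_eq', eval_eq', Finset.mul_sum]
  refine Finset.sum_congr rfl fun d hd => ?_
  have h := hg.degree_eq_sum_deg_support hd
  change n = d.degree at h
  rw [Finsupp.degree_eq_sum] at h
  simp only [Pi.smul_apply, smul_eq_mul, mul_pow, Finset.prod_mul_distrib, Finset.prod_pow_eq_pow_sum]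
  rw [← h]
  ring

variable (b : Module.Basis (Fin 3) ℂ (Fin 3 → ℂ))

/-- The homogeneous coordinates `1, s, t` of the affine chart `ℂ² ⊂ ℙ²`. -/
noncomputable def affineCoord : Fin 3 → MvPolynomial (Fin 2) ℂ := ![1, X 0, X 1]

/-- Restriction of polynomials to the affine plane `b₀ + s b₁ + t b₂` in `ℂ³`, an affine chart of
the projective plane centred at the point `b₀`. -/
noncomputable def chart : PlaneRing →ₐ[ℂ] MvPolynomial (Fin 2) ℂ :=
  aeval fun i => ∑ m, C (b m i) * affineCoord m

/-- The linear form on `ℂ³` dual to the `m`-th vector of the basis `b`. -/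
noncomputable def dualForm (m : Fin 3) : PlaneRing :=
  ∑ i, C (b.coord m (Pi.single i 1)) * X i

theorem isHomogeneous_dualForm (m : Fin 3) : (dualForm b m).IsHomogeneous 1 :=
  IsHomogeneous.sum _ _ _ fun _ _ => isHomogeneous_C_mul_X _ _

theorem eval_dualForm (m : Fin 3) (x : Fin 3 → ℂ) : eval x (dualForm b m) = b.coord m x := by
  have : x = ∑ i, x i • Pi.single (M := fun _ => ℂ) i 1 := by
    ext j
    simp [Finset.sum_apply, Pi.single_apply]
  conv_rhs => rw [this]
  simp [dualForm, mul_comm]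

theorem eval_chart (y : Fin 2 → ℂ) (g : PlaneRing) :
    eval y (chart b g) = eval (b 0 + y 0 • b 1 + y 1 • b 2) g := by
  have : (eval y).comp (chart b).toRingHom = eval (b 0 + y 0 • b 1 + y 1 • b 2) := by
    apply MvPolynomial.ringHom_ext
    · intro r
      simp [chart, algebraMap_eq]
    · intro i
      simp [chart, Fin.sum_univ_three, affineCoord, mul_comm]
  exact RingHom.congr_fun this g

theorem constantCoeff_chart (g : PlaneRing) : constantCoeff (chart b g) = eval (b 0) g := by
  have := eval_chart b 0 g
  simpa [← eval_zero] using this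

@[simp] theorem chart_C (z : ℂ) : chart b (C z) = C z := (chart b).commutes z

theorem chart_dualForm (m : Fin 3) : chart b (dualForm b m) = affineCoord m := by
  apply MvPolynomial.funext
  intro y
  rw [eval_chart, eval_dualForm]
  fin_cases m <;> simp [affineCoord]

/-- A form is determined by its restriction to the chart. -/
theorem eq_zero_of_chart_eq_zero {g : PlaneRing} {n : ℕ} (hg : g.IsHomogeneous n)
    (h : chart b g = 0) : g = 0 := by
  have h0 : dualForm b 0 * g = 0 := by
    apply MvPolynomial.funext
    intro x
    rw [map_mul, eval_dualForm, map_zero]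
    by_cases hx : b.coord 0 x = 0
    · rw [hx, zero_mul]
    · set z := b.coord 0 x
      have h1 := eval_chart b ![z⁻¹ * b.coord 1 x, z⁻¹ * b.coord 2 x] g
      have h2 : z⁻¹ • x = b 0 + (z⁻¹ * b.coord 1 x) • b 1 + (z⁻¹ * b.coord 2 x) • b 2 := by
        have h3 : b.coord 0 x • b 0 + b.coord 1 x • b 1 + b.coord 2 x • b 2 = x := by
          rw [← Fin.sum_univ_three fun m => b.coord m x • b m]
          exact b.sum_repr x
        conv_lhs => rw [← h3]
        rw [smul_add, smul_add, smul_smul, smul_smul, smul_smul, inv_mul_cancel₀ hx, one_smul]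
      rw [h, map_zero] at h1
      simp only [Matrix.cons_val_zero, Matrix.cons_val_one] at h1
      have h4 : eval (z • z⁻¹ • x) g = z ^ n * eval (z⁻¹ • x) g :=
        eval_smul_of_isHomogeneous hg z _
      rw [smul_smul, mul_inv_cancel₀ hx, one_smul, h2, ← h1, mul_zero] at h4
      rw [h4, mul_zero]
  refine (mul_eq_zero.1 h0).resolve_left fun h1 => ?_
  have := eval_dualForm b 0 (b 0)
  rw [h1] at this
  simp at this

/-- Homogenization: a polynomial of degree at most `n` is the restriction of a form of degree
`n`. -/
theorem exists_isHomogeneous_chart_eq {q : MvPolynomial (Fin 2) ℂ} {n : ℕ}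
    (hq : ∀ x ∈ q.support, x.degree ≤ n) :
    ∃ g : PlaneRing, g.IsHomogeneous n ∧ chart b g = q := by
  refine ⟨∑ x ∈ q.support, C (q.coeff x) *
    (dualForm b 1 ^ x 0 * dualForm b 2 ^ x 1 * dualForm b 0 ^ (n - x.degree)), ?_, ?_⟩
  · refine IsHomogeneous.sum _ _ _ fun x hx => IsHomogeneous.C_mul ?_ _
    have h := (((isHomogeneous_dualForm b 1).pow (x 0)).mul
      ((isHomogeneous_dualForm b 2).pow (x 1))).mul
      ((isHomogeneous_dualForm b 0).pow (n - x.degree))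
    have hx' := hq x hx
    have hd : x.degree = x 0 + x 1 := by rw [Finsupp.degree_eq_sum, Fin.sum_univ_two]
    rwa [show 1 * x 0 + 1 * x 1 + 1 * (n - x.degree) = n by omega] at h
  · rw [map_sum]
    conv_rhs => rw [q.as_sum]
    refine Finset.sum_congr rfl fun x _ => ?_
    simp only [map_mul, map_pow, chart_C, chart_dualForm]
    rw [monomial_eq, Finsupp.prod_fintype _ _ (by simp), Fin.prod_univ_two]
    simp [affineCoord]

theorem pderiv_chart (i : Fin 2) (g : PlaneRing) :
    pderiv i (chart b g) = ∑ k, C (b i.succ k) * chart b (pderiv k g) := by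
  induction g using MvPolynomial.induction_on with
  | C z => simp
  | add p q hp hq => simp only [map_add, hp, hq, mul_add, Finset.sum_add_distrib]
  | mul_X p j hp =>
    have hX : pderiv i (chart b (X j)) = C (b i.succ j) := by
      fin_cases i <;> simp [chart, Fin.sum_univ_three, affineCoord]
    rw [map_mul, Derivation.leibniz, hp, hX]
    simp only [Derivation.leibniz, smul_eq_mul, map_add, map_mul, mul_add,
      Finset.sum_add_distrib, pderiv_X]
    congr 1
    · rw [Finset.sum_eq_single j]
      · simp; ring
      · intro k _ hk
        simp [hk]
      · simp
    · rw [Finset.mul_sum]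
      exact Finset.sum_congr rfl fun k _ => by ring

/-- The coefficients of the linear part of the equation of a curve at a point are the derivatives
of the form in the directions of the chart. -/
theorem constantCoeff_pderiv_chart (i : Fin 2) (g : PlaneRing) :
    constantCoeff (pderiv i (chart b g)) = gradientAt g (b 0) ⬝ᵥ b i.succ := by
  rw [pderiv_chart, map_sum]
  simp [constantCoeff_chart, dotProduct, gradientAt, mul_comm]

end Chart

/-! ### Homogeneous ideals in a chart -/

section LocalToGlobal

variable (b : Module.Basis (Fin 3) ℂ (Fin 3 → ℂ)) {f : PlaneRing} {n r : ℕ}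

theorem pderiv_mem_jacobianIdeal (i : Fin 3) : pderiv i f ∈ jacobianIdeal f :=
  Ideal.subset_span ⟨i, rfl⟩

/-- The derivative of `f` in the direction of the basis vector `b m`. -/
noncomputable def dirDeriv (f : PlaneRing) (m : Fin 3) : PlaneRing := ∑ k, C (b m k) * pderiv k f

theorem dirDeriv_mem_jacobianIdeal (m : Fin 3) : dirDeriv b f m ∈ jacobianIdeal f :=
  Ideal.sum_mem _ fun k _ => Ideal.mul_mem_left _ _ (pderiv_mem_jacobianIdeal k)

theorem isHomogeneous_dirDeriv (hf : f.IsHomogeneous n) (m : Fin 3) :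
    (dirDeriv b f m).IsHomogeneous (n - 1) :=
  IsHomogeneous.sum _ _ _ fun _ _ => hf.pderiv.C_mul _

theorem chart_dirDeriv_succ (i : Fin 2) :
    chart b (dirDeriv b f i.succ) = pderiv i (chart b f) := by
  rw [pderiv_chart, dirDeriv, map_sum]
  simp

/-- Euler's formula, read in the chart. -/
theorem chart_dirDeriv_zero (hf : f.IsHomogeneous n) :
    chart b (dirDeriv b f 0) = (n : MvPolynomial (Fin 2) ℂ) * chart b f -
      (X 0 * pderiv 0 (chart b f) + X 1 * pderiv 1 (chart b f)) := by
  have h := congrArg (chart b) hf.sum_X_mul_pderiv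
  rw [nsmul_eq_mul, map_mul, map_natCast, map_sum] at h
  rw [← h, ← chart_dirDeriv_succ, ← chart_dirDeriv_succ, dirDeriv, dirDeriv, dirDeriv, map_sum,
    map_sum, map_sum, Finset.mul_sum, Finset.mul_sum, ← Finset.sum_add_distrib,
    ← Finset.sum_sub_distrib]
  refine Finset.sum_congr rfl fun k _ => ?_
  have hX : chart b (X k) = C (b 0 k) + C (b 1 k) * X 0 + C (b 2 k) * X 1 := by
    simp [chart, Fin.sum_univ_three, affineCoord]
  simp only [map_mul, chart_C, hX, Fin.succ_zero_eq_one, Fin.succ_one_eq_two]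
  ring

theorem pderiv_eq_sum_dirDeriv (i : Fin 3) :
    pderiv i f = ∑ m, C (b.coord m (Pi.single i 1)) * dirDeriv b f m := by
  simp only [dirDeriv, Finset.mul_sum]
  rw [Finset.sum_comm]
  have h : ∀ k, ∑ m, b.coord m (Pi.single i 1) * b m k = (Pi.single i 1 : Fin 3 → ℂ) k := by
    intro k
    have := congrFun (b.sum_repr (Pi.single i 1)) k
    simpa [Finset.sum_apply] using this
  have h' : ∀ k, ∑ m, C (b.coord m (Pi.single i 1)) * (C (b m k) * pderiv k f) =
      C ((Pi.single i 1 : Fin 3 → ℂ) k) * pderiv k f := by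
    intro k
    rw [← h k, map_sum, Finset.sum_mul]
    exact Finset.sum_congr rfl fun m _ => by rw [C_mul, mul_assoc]
  simp only [h']
  rw [Finset.sum_eq_single i]
  · simp
  · intro k _ hk
    simp [hk]
  · simp

/-- At a point of multiplicity at most four, restriction to the chart carries the Jacobian ideal of
`f` into the truncated one. -/
theorem chart_mem_of_mem_jacobianIdeal (hf : f.IsHomogeneous n) (hr : 2 ≤ r) (hr4 : r ≤ 4)
    (hF : chart b f ∈ idealOfVars (Fin 2) ℂ ^ r) {g : PlaneRing} (hg : g ∈ jacobianIdeal f) :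
    chart b g ∈ truncatedJacobian r (chart b f) := by
  suffices jacobianIdeal f ≤ (truncatedJacobian r (chart b f)).comap (chart b) from this hg
  rw [jacobianIdeal, Ideal.span_le]
  rintro _ ⟨i, rfl⟩
  change chart b (pderiv i f) ∈ truncatedJacobian r (chart b f)
  rw [pderiv_eq_sum_dirDeriv b i, map_sum]
  refine Ideal.sum_mem _ fun m _ => ?_
  rw [map_mul]
  refine Ideal.mul_mem_left _ _ ?_
  refine Fin.cases ?_ (fun i => ?_) m
  · rw [chart_dirDeriv_zero b hf]
    exact Ideal.sub_mem _ (Ideal.mul_mem_left _ _ (self_mem_truncatedJacobian hr hr4 hF))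
      (Ideal.add_mem _ (Ideal.mul_mem_left _ _ pderiv_zero_mem_truncatedJacobian)
        (Ideal.mul_mem_left _ _ pderiv_one_mem_truncatedJacobian))
  · rw [chart_dirDeriv_succ]
    fin_cases i
    exacts [pderiv_zero_mem_truncatedJacobian, pderiv_one_mem_truncatedJacobian]

theorem degree_le_totalDegree_of_mem_support {σ : Type*} {q : MvPolynomial σ ℂ} {x : σ →₀ ℕ}
    (hx : x ∈ q.support) : x.degree ≤ q.totalDegree :=
  le_totalDegree hx

/-- Homogenizing a relation valid in the chart: a form whose restriction to the chart lies in the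
truncated Jacobian ideal lies in the Jacobian ideal locally at the centre of the chart. -/
theorem exists_mul_mem_jacobianIdeal (hf : f.IsHomogeneous n) (hr : 2 ≤ r)
    (hF : chart b f ∈ idealOfVars (Fin 2) ℂ ^ r)
    (hG : HasIndependentPartials r (homogeneousComponent r (chart b f)))
    {g : PlaneRing} {j : ℕ} (hg : g.IsHomogeneous j)
    (h : chart b g ∈ truncatedJacobian r (chart b f)) :
    ∃ (H : PlaneRing) (m : ℕ), H.IsHomogeneous m ∧ eval (b 0) H ≠ 0 ∧ H * g ∈ jacobianIdeal f := by
  obtain ⟨q, hq, hle⟩ := exists_mul_truncatedJacobian_le hr hF hG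
  obtain ⟨α, β, hαβ⟩ := Ideal.mem_span_pair.1 (hle _ h)
  set D := q.totalDegree + α.totalDegree + β.totalDegree with hD
  obtain ⟨H, hH, hHq⟩ := exists_isHomogeneous_chart_eq b (q := q) (n := D + (n - 1))
    fun x hx => (degree_le_totalDegree_of_mem_support hx).trans (by omega)
  obtain ⟨A, hA, hAα⟩ := exists_isHomogeneous_chart_eq b (q := α) (n := D + j)
    fun x hx => (degree_le_totalDegree_of_mem_support hx).trans (by omega)
  obtain ⟨B, hB, hBβ⟩ := exists_isHomogeneous_chart_eq b (q := β) (n := D + j)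
    fun x hx => (degree_le_totalDegree_of_mem_support hx).trans (by omega)
  refine ⟨H, _, hH, ?_, ?_⟩
  · rw [← constantCoeff_chart, hHq, hq]
    exact one_ne_zero
  · have h1 := hH.mul hg
    have h2 := (hA.mul (isHomogeneous_dirDeriv b hf 1)).add
      (hB.mul (isHomogeneous_dirDeriv b hf 2))
    rw [show D + j + (n - 1) = D + (n - 1) + j by ring] at h2
    have h3 := eq_zero_of_chart_eq_zero b (h1.sub h2) (by
      have e1 := chart_dirDeriv_succ b (f := f) 0
      have e2 := chart_dirDeriv_succ b (f := f) 1
      rw [Fin.succ_zero_eq_one] at e1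
      rw [Fin.succ_one_eq_two] at e2
      rw [map_sub, map_add, map_mul, map_mul, map_mul, hHq, hAα, hBβ, e1, e2, hαβ, sub_self])
    rw [sub_eq_zero.1 h3]
    exact Ideal.add_mem _ (Ideal.mul_mem_left _ _ (dirDeriv_mem_jacobianIdeal b 1))
      (Ideal.mul_mem_left _ _ (dirDeriv_mem_jacobianIdeal b 2))

theorem mem_idealOfVars_iff_constantCoeff {σ : Type*} {q : MvPolynomial σ ℂ} :
    q ∈ idealOfVars σ ℂ ↔ constantCoeff q = 0 := by
  rw [← pow_one (idealOfVars σ ℂ), mem_pow_idealOfVars_iff', constantCoeff_eq]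
  constructor
  · intro h
    exact h 0 (by simp)
  · intro h x hx
    have : x = 0 := (Finsupp.degree_eq_zero_iff x).1 (by omega)
    rw [this, h]

/-- A polynomial that does not vanish at the origin is invertible modulo terms of order `k`. -/
theorem exists_mul_sub_one_mem_pow {q : MvPolynomial (Fin 2) ℂ} (hq : constantCoeff q ≠ 0)
    (k : ℕ) : ∃ q' : MvPolynomial (Fin 2) ℂ, q * q' - 1 ∈ idealOfVars (Fin 2) ℂ ^ k := by
  set z := constantCoeff q with hz
  set e := 1 - C z⁻¹ * q with he
  have he1 : e ∈ idealOfVars (Fin 2) ℂ := by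
    rw [mem_idealOfVars_iff_constantCoeff, he]
    simp [← hz, inv_mul_cancel₀ hq]
  refine ⟨C z⁻¹ * ∑ i ∈ Finset.range k, e ^ i, ?_⟩
  have h : q * (C z⁻¹ * ∑ i ∈ Finset.range k, e ^ i) - 1 = - e ^ k := by
    have := mul_neg_geom_sum e k
    have h2 : C z⁻¹ * q = 1 - e := by rw [he]; ring
    linear_combination this + (∑ i ∈ Finset.range k, e ^ i) * h2
  rw [h]
  exact neg_mem (Ideal.pow_mem_pow he1 k)

end LocalToGlobal

/-! ### The leading form at an ordinary point -/

section OrdinaryPoint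

variable (b : Module.Basis (Fin 3) ℂ (Fin 3 → ℂ))

theorem gradient_dotProduct_self {g : PlaneRing} {n : ℕ} (hg : g.IsHomogeneous n)
    (v : Fin 3 → ℂ) : gradientAt g v ⬝ᵥ v = n * eval v g := by
  have h := congrArg (eval v) hg.sum_X_mul_pderiv
  rw [nsmul_eq_mul, map_mul, map_natCast, map_sum] at h
  rw [← h]
  simp [dotProduct, gradientAt, mul_comm]

theorem homogeneousComponent_one_eq (q : MvPolynomial (Fin 2) ℂ) :
    homogeneousComponent 1 q =
      binaryLinearForm (constantCoeff (pderiv 0 q)) (constantCoeff (pderiv 1 q)) := by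
  have h := (homogeneousComponent_isHomogeneous 1 q).sum_X_mul_pderiv
  rw [Fin.sum_univ_two, pderiv_homogeneousComponent, pderiv_homogeneousComponent,
    homogeneousComponent_zero, homogeneousComponent_zero, one_smul] at h
  rw [← h, binaryLinearForm]
  simp only [constantCoeff_eq]
  ring

/-- Two linear forms on `ℂ³` that vanish at `b 0` and are linearly independent remain independent
on the span of `b 1` and `b 2`. -/
theorem det_ne_zero_of_linearIndependent {α β : Fin 3 → ℂ} (h : LinearIndependent ℂ ![α, β])
    (hα : α ⬝ᵥ b 0 = 0) (hβ : β ⬝ᵥ b 0 = 0) :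
    (α ⬝ᵥ b 1) * (β ⬝ᵥ b 2) - (α ⬝ᵥ b 2) * (β ⬝ᵥ b 1) ≠ 0 := by
  intro h0
  have hext : ∀ γ : Fin 3 → ℂ, (∀ m, γ ⬝ᵥ b m = 0) → γ = 0 := by
    intro γ hγ
    have : dotProductBilin ℂ ℂ γ = (0 : (Fin 3 → ℂ) →ₗ[ℂ] ℂ) :=
      b.ext fun m => by simpa using hγ m
    exact dotProduct_eq_zero γ fun w => by simpa using LinearMap.congr_fun this w
  rw [LinearIndependent.pair_iff] at h
  have key : ∀ x y : ℂ, x * (α ⬝ᵥ b 1) + y * (β ⬝ᵥ b 1) = 0 →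
      x * (α ⬝ᵥ b 2) + y * (β ⬝ᵥ b 2) = 0 → x = 0 ∧ y = 0 := by
    intro x y h1 h2
    refine h x y (hext _ fun m => ?_)
    fin_cases m <;> simp [add_dotProduct, smul_dotProduct, hα, hβ, h1, h2]
  obtain ⟨h1, h2⟩ := key (β ⬝ᵥ b 1) (-(α ⬝ᵥ b 1)) (by ring) (by linear_combination -h0)
  obtain ⟨h3, h4⟩ := key (β ⬝ᵥ b 2) (-(α ⬝ᵥ b 2)) (by linear_combination h0) (by ring)
  exact one_ne_zero (key 1 0 (by linear_combination -h2) (by linear_combination -h4)).1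

/-- In a chart centred at an ordinary point through which `r` curves pass, the leading form of the
product of all the equations is, up to a constant, the product of the equations of the `r`
tangent lines. -/
theorem chart_prod_mem_pow_and_hasIndependentPartials {ι : Type*} [Fintype ι] (g : ι → PlaneRing)
    (deg : ι → ℕ) (hg : ∀ i, (g i).IsHomogeneous (deg i)) (T : Finset ι)
    (hT : ∀ i, i ∈ T ↔ eval (b 0) (g i) = 0) (hT2 : 2 ≤ T.card)
    (hord : ∀ i ∈ T, ∀ j ∈ T, i ≠ j →
      LinearIndependent ℂ ![gradientAt (g i) (b 0), gradientAt (g j) (b 0)]) :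
    chart b (∏ i, g i) ∈ idealOfVars (Fin 2) ℂ ^ T.card ∧
      HasIndependentPartials T.card (homogeneousComponent T.card (chart b (∏ i, g i))) := by
  classical
  have hsplit : chart b (∏ i, g i) = (∏ i ∈ Tᶜ, chart b (g i)) * ∏ i ∈ T, chart b (g i) := by
    rw [map_prod, Finset.prod_compl_mul_prod]
  obtain ⟨h1, h2⟩ := prod_mem_pow_and_homogeneousComponent_prod T (fun i => chart b (g i))
    fun i hi => by
      rw [mem_idealOfVars_iff_constantCoeff, constantCoeff_chart]
      exact (hT i).1 hi
  have h0 : ∏ i ∈ Tᶜ, chart b (g i) ∈ idealOfVars (Fin 2) ℂ ^ 0 := by simp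
  have hk : constantCoeff (∏ i ∈ Tᶜ, chart b (g i)) ≠ 0 := by
    rw [map_prod, Finset.prod_ne_zero_iff]
    intro i hi
    rw [constantCoeff_chart]
    exact fun h => Finset.mem_compl.1 hi ((hT i).2 h)
  rw [hsplit]
  refine ⟨Ideal.mul_mem_left _ _ h1, ?_⟩
  have h3 := homogeneousComponent_mul h0 h1
  rw [zero_add, h2, homogeneousComponent_zero, ← constantCoeff_eq] at h3
  rw [h3]
  simp only [homogeneousComponent_one_eq]
  refine hasIndependentPartials_prod T hT2 _ hk _ _ fun i hi j hj hij => ?_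
  simp only [constantCoeff_pderiv_chart]
  rw [Fin.succ_zero_eq_one, Fin.succ_one_eq_two]
  refine det_ne_zero_of_linearIndependent b (hord i hi j hj hij) ?_ ?_
  · rw [gradient_dotProduct_self (hg i), (hT i).1 hi, mul_zero]
  · rw [gradient_dotProduct_self (hg j), (hT j).1 hj, mul_zero]

end OrdinaryPoint

/-! ### Saturation of homogeneous ideals -/

section Saturation

/-- The saturation of an ideal of `ℂ[x, y, z]` with respect to the irrelevant ideal: the
polynomials that belong to the ideal locally at every point different from the origin. -/
noncomputable def pointwiseSaturation (I : Ideal PlaneRing) : Ideal PlaneRing where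
  carrier := {g | ∀ v : Fin 3 → ℂ, v ≠ 0 → ∃ H : PlaneRing, eval v H ≠ 0 ∧ H * g ∈ I}
  zero_mem' := fun _ _ => ⟨1, by simp, by simp⟩
  add_mem' := by
    intro g g' hg hg' v hv
    obtain ⟨H, h1, h2⟩ := hg v hv
    obtain ⟨H', h1', h2'⟩ := hg' v hv
    refine ⟨H * H', by rw [map_mul]; exact mul_ne_zero h1 h1', ?_⟩
    have := I.add_mem (I.mul_mem_left H' h2) (I.mul_mem_left H h2')
    convert this using 1
    ring
  smul_mem' := by
    intro c g hg v hv
    obtain ⟨H, h1, h2⟩ := hg v hv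
    refine ⟨H, h1, ?_⟩
    have := I.mul_mem_left c h2
    rw [smul_eq_mul]
    convert this using 1
    ring

/-- By the Nullstellensatz, an element of the saturation is multiplied into the ideal by a power of
the irrelevant ideal. -/
theorem exists_pow_mul_mem_of_mem_pointwiseSaturation {I : Ideal PlaneRing} {g : PlaneRing}
    (hg : g ∈ pointwiseSaturation I) :
    ∃ k, ∀ a ∈ idealOfVars (Fin 3) ℂ ^ k, a * g ∈ I := by
  let A : Ideal PlaneRing := Submodule.comap (LinearMap.mulRight PlaneRing g) I
  have hA : ∀ a, a ∈ A ↔ a * g ∈ I := fun a => Iff.rfl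
  have hle : idealOfVars (Fin 3) ℂ ≤ A.radical := by
    rw [Ideal.span_le]
    rintro _ ⟨i, rfl⟩
    rw [SetLike.mem_coe, ← vanishingIdeal_zeroLocus_eq_radical (K := ℂ), mem_vanishingIdeal_iff]
    intro v hv
    by_contra h0
    have hv0 : v ≠ 0 := by
      rintro rfl
      simp at h0
    obtain ⟨H, h1, h2⟩ := hg v hv0
    exact h1 (by simpa using hv H ((hA H).2 h2))
  obtain ⟨k, hk⟩ := Ideal.exists_pow_le_of_le_radical_of_fg hle (idealOfVars_fg (Fin 3) ℂ)
  exact ⟨k, fun a ha => (hA a).1 (hk ha)⟩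

theorem exists_totalDegree_le_sub_mem_pow {σ : Type*} (k : ℕ) (p : MvPolynomial σ ℂ) :
    ∃ q : MvPolynomial σ ℂ, q.totalDegree ≤ k ∧ p - q ∈ idealOfVars σ ℂ ^ k := by
  induction k with
  | zero => exact ⟨0, by simp, by simp⟩
  | succ k ih =>
    obtain ⟨q, hq, hpq⟩ := ih
    refine ⟨q + homogeneousComponent k (p - q), ?_, ?_⟩
    · refine (totalDegree_add _ _).trans (max_le (by omega) ?_)
      exact (homogeneousComponent_isHomogeneous k _).totalDegree_le.trans (by omega)
    · rw [← sub_sub]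
      exact sub_homogeneousComponent_mem hpq

attribute [local instance] MvPolynomial.gradedAlgebra

/-- A homogeneous ideal agrees with its saturation in large degrees. -/
theorem exists_forall_mem_of_mem_pointwiseSaturation {I : Ideal PlaneRing}
    (hI : I.IsHomogeneous (homogeneousSubmodule (Fin 3) ℂ)) :
    ∃ j₀, ∀ j ≥ j₀, ∀ g : PlaneRing, g.IsHomogeneous j → g ∈ pointwiseSaturation I → g ∈ I := by
  classical
  obtain ⟨T, hT⟩ := IsNoetherian.noetherian (pointwiseSaturation I)
  have hTmem : ∀ t ∈ T, t ∈ pointwiseSaturation I := fun t ht =>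
    hT ▸ Submodule.subset_span ht
  choose! k hk using fun t (ht : t ∈ T) => exists_pow_mul_mem_of_mem_pointwiseSaturation (hTmem t ht)
  set N := T.sup k with hN
  set D := T.sup totalDegree with hD
  refine ⟨N + D + 1, fun j hj g hg hgK => ?_⟩
  rw [← hT] at hgK
  obtain ⟨a, ha⟩ := Submodule.mem_span_finset.1 hgK
  choose low hlow1 hlow2 using fun t => exists_totalDegree_le_sub_mem_pow N (a t)
  -- Modulo `I`, the coefficients may be truncated at degree `N`, and the resulting combination
  -- has no part of degree `j`.
  have h1 : g - ∑ t ∈ T, low t * t ∈ I := by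
    rw [← ha.2, ← Finset.sum_sub_distrib]
    refine Ideal.sum_mem _ fun t ht => ?_
    rw [smul_eq_mul, ← sub_mul]
    exact hk t ht _ (Ideal.pow_le_pow_right (Finset.le_sup ht) (hlow2 t))
  have h2 : homogeneousComponent j (∑ t ∈ T, low t * t) = 0 := by
    rw [map_sum]
    refine Finset.sum_eq_zero fun t ht => homogeneousComponent_eq_zero _ _ ?_
    have h3 := hlow1 t
    have h4 : t.totalDegree ≤ D := Finset.le_sup ht
    have h5 := totalDegree_mul (low t) t
    omega
  have h3 := homogeneousComponent_mem_of_mem hI h1 j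
  rwa [map_sub, h2, sub_zero, homogeneousComponent_eq_self hg] at h3

theorem isHomogeneous_jacobianIdeal {f : PlaneRing} {n : ℕ} (hf : f.IsHomogeneous n) :
    (jacobianIdeal f).IsHomogeneous (homogeneousSubmodule (Fin 3) ℂ) := by
  refine Ideal.homogeneous_span _ _ ?_
  rintro _ ⟨i, rfl⟩
  exact ⟨n - 1, hf.pderiv⟩

end Saturation

/-! ### The degree of the Jacobian ideal -/

section HilbertFunction

variable {P : Type*} [Fintype P] (b : P → Module.Basis (Fin 3) ℂ (Fin 3 → ℂ)) (r : P → ℕ)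
  {f : PlaneRing} {n : ℕ}

/-- A linear form through the point `b 0` and not through the point `v`. -/
theorem exists_linearForm_separating (b : Module.Basis (Fin 3) ℂ (Fin 3 → ℂ)) {v : Fin 3 → ℂ}
    (hv : ∀ z : ℂ, v ≠ z • b 0) :
    ∃ L : PlaneRing, L.IsHomogeneous 1 ∧ eval (b 0) L = 0 ∧ eval v L ≠ 0 := by
  by_cases h1 : b.coord 1 v = 0
  · by_cases h2 : b.coord 2 v = 0
    · refine absurd ?_ (hv (b.coord 0 v))
      have h3 : b.coord 0 v • b 0 + b.coord 1 v • b 1 + b.coord 2 v • b 2 = v := by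
        rw [← Fin.sum_univ_three fun m => b.coord m v • b m]
        exact b.sum_repr v
      rw [h1, h2, zero_smul, zero_smul, add_zero, add_zero] at h3
      exact h3.symm
    · exact ⟨dualForm b 2, isHomogeneous_dualForm b 2, by rw [eval_dualForm]; simp,
        by rwa [eval_dualForm]⟩
  · exact ⟨dualForm b 1, isHomogeneous_dualForm b 1, by rw [eval_dualForm]; simp,
      by rwa [eval_dualForm]⟩

/-- Forms of large degree restrict to arbitrary given functions on a finite set of fat points. -/
theorem exists_isHomogeneous_chart_sub_mem [DecidableEq P]
    (hsep : ∀ p q, p ≠ q → ∀ z : ℂ, b p 0 ≠ z • b q 0) (N : ℕ) :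
    ∃ j₀, ∀ j ≥ j₀, ∀ y : P → MvPolynomial (Fin 2) ℂ, ∃ g : PlaneRing, g.IsHomogeneous j ∧
      ∀ p, chart (b p) g - y p ∈ idealOfVars (Fin 2) ℂ ^ N := by
  have hL : ∀ p q, ∃ L : PlaneRing, L.IsHomogeneous 1 ∧
      (p ≠ q → eval (b q 0) L = 0 ∧ eval (b p 0) L ≠ 0) := by
    intro p q
    by_cases h : p = q
    · exact ⟨0, isHomogeneous_zero _ _ _, fun h' => absurd h h'⟩
    · obtain ⟨L, h1, h2⟩ := exists_linearForm_separating (b q) (hsep p q h)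
      exact ⟨L, h1, fun _ => h2⟩
  choose L hL1 hL2 using hL
  set e : P → PlaneRing := fun p => ∏ q ∈ Finset.univ.erase p, L p q ^ N with he
  set d := (Fintype.card P - 1) * N with hd
  have hehom : ∀ p, (e p).IsHomogeneous d := by
    intro p
    have := IsHomogeneous.prod (Finset.univ.erase p) (fun q => L p q ^ N) (fun _ => 1 * N)
      fun q _ => (hL1 p q).pow N
    rw [Finset.sum_const, Finset.card_erase_of_mem (Finset.mem_univ p), Finset.card_univ,
      one_mul, smul_eq_mul] at this
    exact this
  have he0 : ∀ p q, p ≠ q → chart (b q) (e p) ∈ idealOfVars (Fin 2) ℂ ^ N := by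
    intro p q hpq
    simp only [he]
    rw [← Finset.mul_prod_erase _ _ (Finset.mem_erase.2 ⟨hpq.symm, Finset.mem_univ q⟩),
      map_mul, map_pow]
    refine Ideal.mul_mem_right _ _ (Ideal.pow_mem_pow ?_ N)
    rw [mem_idealOfVars_iff_constantCoeff, constantCoeff_chart]
    exact (hL2 p q hpq).1
  have he1 : ∀ p, constantCoeff (chart (b p) (e p)) ≠ 0 := by
    intro p
    rw [constantCoeff_chart, map_prod, Finset.prod_ne_zero_iff]
    intro q hq
    rw [map_pow]
    exact pow_ne_zero _ (hL2 p q (Finset.ne_of_mem_erase hq).symm).2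
  choose u hu using fun p => exists_mul_sub_one_mem_pow (he1 p) N
  refine ⟨d + N, fun j hj y => ?_⟩
  choose z hz1 hz2 using fun p => exists_mem_polysDegreeLT_sub_mem N (u p * y p)
  choose g hg1 hg2 using fun p => exists_isHomogeneous_chart_eq (b p) (q := z p) (n := j - d)
    fun x hx => le_of_lt (lt_of_lt_of_le (hz1 p hx) (by omega))
  refine ⟨∑ p, g p * e p, IsHomogeneous.sum _ _ _ fun p _ => ?_, fun p => ?_⟩
  · have := (hg1 p).mul (hehom p)
    rwa [show j - d + d = j by omega] at this
  · rw [map_sum, ← Finset.add_sum_erase _ _ (Finset.mem_univ p), add_sub_right_comm]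
    refine Ideal.add_mem _ ?_ (Ideal.sum_mem _ fun q hq => ?_)
    · rw [map_mul, hg2]
      have h1 := Ideal.mul_mem_right (y p) _ (hu p)
      have h2 := Ideal.mul_mem_left _ (chart (b p) (e p)) (hz2 p)
      convert Ideal.sub_mem _ h1 h2 using 1
      ring
    · rw [map_mul]
      exact Ideal.mul_mem_left _ _ (he0 q p (Finset.ne_of_mem_erase hq))

/-- The degree of the Jacobian ideal of a curve all of whose singular points have reduced tangent
cones of degree at most four is the sum of the `(r_p - 1)²`. -/
theorem hasZeroDimDegree_jacobianIdeal (hf : f.IsHomogeneous n)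
    (hr : ∀ p, 2 ≤ r p) (hr4 : ∀ p, r p ≤ 4)
    (hF : ∀ p, chart (b p) f ∈ idealOfVars (Fin 2) ℂ ^ r p)
    (hG : ∀ p, HasIndependentPartials (r p) (homogeneousComponent (r p) (chart (b p) f)))
    (hsep : ∀ p q, p ≠ q → ∀ z : ℂ, b p 0 ≠ z • b q 0)
    (hsing : ∀ v : Fin 3 → ℂ, v ≠ 0 → gradientAt f v = 0 → ∃ p, ∃ z : ℂ, v = z • b p 0) :
    HasZeroDimDegree (jacobianIdeal f) (∑ p, (r p - 1) ^ 2) := by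
  classical
  -- The exponent `5` is at least `2 r - 3` for all `r ≤ 4`.
  obtain ⟨j₁, hj₁⟩ := exists_isHomogeneous_chart_sub_mem b hsep 5
  obtain ⟨j₂, hj₂⟩ :=
    exists_forall_mem_of_mem_pointwiseSaturation (isHomogeneous_jacobianIdeal hf)
  filter_upwards [eventually_ge_atTop (max j₁ j₂)] with j hj
  have hfin := fun p => (finrank_quotient_truncatedJacobian (hr p) (hF p) (hG p)).1
  have hrank := fun p => (finrank_quotient_truncatedJacobian (hr p) (hF p) (hG p)).2
  let S := homogeneousSubmodule (Fin 3) ℂ j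
  let π : S →ₗ[ℂ] PlaneRing ⧸ jacobianIdeal f :=
    (Ideal.Quotient.mkₐ ℂ (jacobianIdeal f)).toLinearMap ∘ₗ S.subtype
  let Φ : S →ₗ[ℂ] ∀ p, MvPolynomial (Fin 2) ℂ ⧸ truncatedJacobian (r p) (chart (b p) f) :=
    LinearMap.pi fun p => (Ideal.Quotient.mkₐ ℂ (truncatedJacobian (r p) (chart (b p) f))).toLinearMap
      ∘ₗ (chart (b p)).toLinearMap ∘ₗ S.subtype
  have hΦ : ∀ g : S, Φ g = 0 ↔ ∀ p, chart (b p) g ∈ truncatedJacobian (r p) (chart (b p) f) := by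
    intro g
    rw [funext_iff]
    exact forall_congr' fun p => Ideal.Quotient.eq_zero_iff_mem
  have hπ : ∀ g : S, π g = 0 ↔ (g : PlaneRing) ∈ jacobianIdeal f := fun g =>
    Ideal.Quotient.eq_zero_iff_mem
  have hsurj : Function.Surjective Φ := by
    intro y
    choose y' hy' using fun p => Ideal.Quotient.mk_surjective (y p)
    obtain ⟨g, hg, hgy⟩ := hj₁ j (le_trans (le_max_left _ _) hj) y'
    refine ⟨⟨g, hg⟩, funext fun p => ?_⟩
    rw [← hy' p]
    refine Ideal.Quotient.eq.2 (pow_le_truncatedJacobian (Ideal.pow_le_pow_right ?_ (hgy p)))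
    have := hr4 p
    omega
  have hker : LinearMap.ker π = LinearMap.ker Φ := by
    ext g
    rw [LinearMap.mem_ker, LinearMap.mem_ker, hπ, hΦ]
    constructor
    · exact fun h p => chart_mem_of_mem_jacobianIdeal (b p) hf (hr p) (hr4 p) (hF p) h
    · intro h
      refine hj₂ j (le_trans (le_max_right _ _) hj) g g.2 fun v hv => ?_
      by_cases hgrad : gradientAt f v = 0
      · obtain ⟨p, z, rfl⟩ := hsing v hv hgrad
        obtain ⟨H, m, hH, h1, h2⟩ :=
          exists_mul_mem_jacobianIdeal (b p) hf (hr p) (hF p) (hG p) g.2 (h p)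
        have hz : z ≠ 0 := by
          rintro rfl
          exact hv (zero_smul _ _)
        exact ⟨H, by rw [eval_smul_of_isHomogeneous hH]; exact mul_ne_zero (pow_ne_zero _ hz) h1, h2⟩
      · obtain ⟨i, hi⟩ := Function.ne_iff.1 hgrad
        exact ⟨pderiv i f, hi, Ideal.mul_mem_right _ _ (pderiv_mem_jacobianIdeal i)⟩
  have h1 : quotientHilbertFunction (jacobianIdeal f) j = Module.finrank ℂ (LinearMap.range π) := by
    rw [quotientHilbertFunction, LinearMap.range_comp, Submodule.range_subtype]
  rw [h1, ← π.quotKerEquivRange.finrank_eq, hker, Φ.quotKerEquivRange.finrank_eq,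
    LinearMap.range_eq_top.2 hsurj, finrank_top, Module.finrank_pi_fintype]
  exact Finset.sum_congr rfl fun p _ => hrank p

end HilbertFunction

/-! ### Intersections of lines and conics -/

section PlaneIntersections

theorem exists_basis_zero_eq {v : Fin 3 → ℂ} (hv : v ≠ 0) :
    ∃ b : Module.Basis (Fin 3) ℂ (Fin 3 → ℂ), b 0 = v := by
  have hli : LinearIndepOn ℂ id ({v} : Set (Fin 3 → ℂ)) := LinearIndepOn.singleton (by simpa using hv)
  let B := Module.Basis.extend hli
  have hmem : v ∈ hli.extend (Set.subset_univ _) := hli.subset_extend _ rfl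
  have := Module.Finite.finite_basis B
  let e := Finite.equivFinOfCardEq (n := 3)
    (by rw [← Module.finrank_eq_nat_card_basis B]; simp : Nat.card (hli.extend (Set.subset_univ _)) = 3)
  refine ⟨B.reindex (e.trans (Equiv.swap (e ⟨v, hmem⟩) 0)), ?_⟩
  simp [B]

theorem dotProduct_eq_of_basis (b : Module.Basis (Fin 3) ℂ (Fin 3 → ℂ)) (α u : Fin 3 → ℂ) :
    α ⬝ᵥ u = b.coord 0 u * (α ⬝ᵥ b 0) + b.coord 1 u * (α ⬝ᵥ b 1) + b.coord 2 u * (α ⬝ᵥ b 2) := by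
  have h3 : b.coord 0 u • b 0 + b.coord 1 u • b 1 + b.coord 2 u • b 2 = u := by
    rw [← Fin.sum_univ_three fun m => b.coord m u • b m]
    exact b.sum_repr u
  conv_lhs => rw [← h3]
  simp [dotProduct_add, dotProduct_smul]

/-- The line `α = 0` in the projective plane is spanned by any of its points and a second one. -/
theorem exists_param_of_dotProduct_eq_zero {α v : Fin 3 → ℂ} (hα : α ≠ 0) (hv : v ≠ 0)
    (h : α ⬝ᵥ v = 0) : ∃ w : Fin 3 → ℂ, LinearIndependent ℂ ![v, w] ∧
      ∀ u, α ⬝ᵥ u = 0 ↔ ∃ s t : ℂ, u = s • v + t • w := by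
  obtain ⟨b, rfl⟩ := exists_basis_zero_eq hv
  set x := α ⬝ᵥ b 1 with hx
  set y := α ⬝ᵥ b 2 with hy
  have hxy : x ≠ 0 ∨ y ≠ 0 := by
    by_contra! hxy
    apply hα
    refine dotProduct_eq_zero α fun u => ?_
    rw [dotProduct_eq_of_basis b, h, ← hx, ← hy, hxy.1, hxy.2]
    ring
  refine ⟨x • b 2 - y • b 1, ?_, fun u => ⟨fun hu => ?_, ?_⟩⟩
  · rw [LinearIndependent.pair_iff]
    intro s t hst
    have h0 := congrArg (b.coord 0) hst
    have h1 := congrArg (b.coord 1) hst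
    have h2 := congrArg (b.coord 2) hst
    simp at h0 h1 h2
    refine ⟨h0, ?_⟩
    rcases hxy with hh | hh
    · exact h2.resolve_right hh
    · exact h1.resolve_right hh
  · rw [dotProduct_eq_of_basis b, h, ← hx, ← hy, mul_zero, zero_add] at hu
    have h3 : b.coord 0 u • b 0 + b.coord 1 u • b 1 + b.coord 2 u • b 2 = u := by
      rw [← Fin.sum_univ_three fun m => b.coord m u • b m]
      exact b.sum_repr u
    rcases hxy with hh | hh
    · refine ⟨b.coord 0 u, b.coord 2 u / x, ?_⟩
      have h1 : b.coord 1 u = -(b.coord 2 u / x) * y := by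
        field_simp
        linear_combination hu
      conv_lhs => rw [← h3, h1]
      have h2 : b.coord 2 u = b.coord 2 u / x * x := by field_simp
      conv_lhs => rw [h2]
      rw [mul_div_cancel_right₀ _ hh, smul_sub, smul_smul, smul_smul, neg_mul, neg_smul]
      abel
    · refine ⟨b.coord 0 u, -(b.coord 1 u / y), ?_⟩
      have h1 : b.coord 2 u = -(b.coord 1 u / y) * x := by
        field_simp
        linear_combination hu
      conv_lhs => rw [← h3, h1]
      have h2 : b.coord 1 u = b.coord 1 u / y * y := by field_simp
      conv_lhs => rw [h2]
      rw [mul_div_cancel_right₀ _ hh, smul_sub, smul_smul, smul_smul, neg_mul, neg_smul]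
      rw [neg_mul, neg_smul]
      abel
  · rintro ⟨s, t, rfl⟩
    simp only [dotProduct_add, dotProduct_sub, dotProduct_smul, h, ← hx, ← hy, smul_eq_mul]
    ring

theorem gradientAt_eq_of_isHomogeneous_one {L : PlaneRing} (hL : L.IsHomogeneous 1)
    (v w : Fin 3 → ℂ) : gradientAt L v = gradientAt L w := by
  funext i
  have h : (pderiv i L).IsHomogeneous 0 := hL.pderiv
  rw [← totalDegree_zero_iff_isHomogeneous, totalDegree_eq_zero_iff_eq_C] at h
  rw [gradientAt, gradientAt, h, eval_C, eval_C]

theorem eval_eq_gradient_dotProduct {L : PlaneRing} (hL : L.IsHomogeneous 1) (v : Fin 3 → ℂ) :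
    eval v L = gradientAt L 0 ⬝ᵥ v := by
  rw [gradientAt_eq_of_isHomogeneous_one hL 0 v, gradient_dotProduct_self hL, Nat.cast_one, one_mul]

theorem eval_add_smul_of_isHomogeneous_one {L : PlaneRing} (hL : L.IsHomogeneous 1) (s t : ℂ)
    (v w : Fin 3 → ℂ) : eval (s • v + t • w) L = s * eval v L + t * eval w L := by
  simp only [eval_eq_gradient_dotProduct hL, dotProduct_add, dotProduct_smul, smul_eq_mul]

theorem gradientAt_ne_zero {L : PlaneRing} (hL : L.IsHomogeneous 1) (hL0 : L ≠ 0) :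
    gradientAt L 0 ≠ 0 := by
  intro h
  apply hL0
  apply MvPolynomial.funext
  intro v
  rw [eval_eq_gradient_dotProduct hL, h, zero_dotProduct, map_zero]

theorem linearIndependent_gradientAt_of_not_associated {L L' : PlaneRing} (hL : L.IsHomogeneous 1)
    (hL' : L'.IsHomogeneous 1) (hL0 : L ≠ 0) (hL0' : L' ≠ 0) (h : ¬ Associated L L') :
    LinearIndependent ℂ ![gradientAt L 0, gradientAt L' 0] := by
  rw [LinearIndependent.pair_iff' (gradientAt_ne_zero hL hL0)]
  intro z hz
  have hLz : L' = L * C z := by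
    apply MvPolynomial.funext
    intro v
    rw [map_mul, eval_eq_gradient_dotProduct hL, eval_eq_gradient_dotProduct hL', ← hz, eval_C,
      smul_dotProduct, smul_eq_mul, mul_comm]
  have hz0 : z ≠ 0 := by
    rintro rfl
    exact hL0' (by rw [hLz, C_0, mul_zero])
  exact h ⟨((isUnit_iff_ne_zero.2 hz0).map (C (σ := Fin 3))).unit, hLz.symm⟩

/-- The vanishing of a form at a point does not depend on the representative. -/
theorem eval_rep_mk_eq_zero_iff {g : PlaneRing} {n : ℕ} (hg : g.IsHomogeneous n) {v : Fin 3 → ℂ}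
    (hv : v ≠ 0) : eval (Projectivization.mk ℂ v hv).rep g = 0 ↔ eval v g = 0 := by
  obtain ⟨a, ha⟩ := Projectivization.exists_smul_eq_mk_rep ℂ v hv
  rw [← ha, Units.smul_def, eval_smul_of_isHomogeneous hg]
  simp

/-- The points common to two curves. -/
def commonPoints (g g' : PlaneRing) : Set ProjPlane :=
  {p | eval p.rep g = 0 ∧ eval p.rep g' = 0}

theorem commonPoints_comm (g g' : PlaneRing) : commonPoints g g' = commonPoints g' g := by
  ext p
  exact and_comm

/-- Two different lines meet in exactly one point. -/
theorem ncard_commonPoints_line_line {L L' : PlaneRing} (hL : L.IsHomogeneous 1)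
    (hL' : L'.IsHomogeneous 1) (hL0 : L ≠ 0) (hL0' : L' ≠ 0) (h : ¬ Associated L L') :
    (commonPoints L L').ncard = 1 := by
  have hli := linearIndependent_gradientAt_of_not_associated hL hL' hL0 hL0' h
  have hw := crossProduct_ne_zero_iff_linearIndependent.2 hli
  rw [Set.ncard_eq_one]
  refine ⟨Projectivization.mk ℂ _ hw, ?_⟩
  ext p
  rw [Set.mem_singleton_iff]
  constructor
  · rintro ⟨h1, h2⟩
    rw [eval_eq_gradient_dotProduct hL] at h1
    rw [eval_eq_gradient_dotProduct hL'] at h2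
    rw [← p.mk_rep, Projectivization.mk_eq_mk_iff_crossProduct_eq_zero]
    exact (Configuration.ofField.crossProduct_eq_zero_of_dotProduct_eq_zero h1 h2
      (dot_self_cross _ _) (dot_cross_self _ _)).resolve_left hw
  · rintro rfl
    refine ⟨(eval_rep_mk_eq_zero_iff hL hw).2 ?_, (eval_rep_mk_eq_zero_iff hL' hw).2 ?_⟩
    · rw [eval_eq_gradient_dotProduct hL]
      exact dot_self_cross _ _
    · rw [eval_eq_gradient_dotProduct hL']
      exact dot_cross_self _ _

/-- The restriction of a quadratic form to a line. -/
theorem eval_add_of_isHomogeneous_two {Q : PlaneRing} (hQ : Q.IsHomogeneous 2) (s t : ℂ)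
    (v w : Fin 3 → ℂ) : eval (s • v + t • w) Q =
      s ^ 2 * eval v Q + s * t * (gradientAt Q v ⬝ᵥ w) + t ^ 2 * eval w Q := by
  have hQ' : Q ∈ homogeneousSubmodule (Fin 3) ℂ 1 * homogeneousSubmodule (Fin 3) ℂ 1 := by
    rw [← pow_two, homogeneousSubmodule_one_pow]
    exact hQ
  induction hQ' using Submodule.mul_induction_on' with
  | mem_mul_mem L hL L' hL' =>
    have e : ∀ u, gradientAt (L * L') u = eval u L • gradientAt L' 0 + eval u L' • gradientAt L 0 := by
      intro u
      rw [gradientAt_eq_of_isHomogeneous_one hL 0 u, gradientAt_eq_of_isHomogeneous_one hL' 0 u]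
      funext i
      simp [gradientAt, Derivation.leibniz]
    rw [e]
    simp only [map_mul, eval_add_smul_of_isHomogeneous_one hL,
      eval_add_smul_of_isHomogeneous_one hL', add_dotProduct, smul_dotProduct,
      ← eval_eq_gradient_dotProduct hL, ← eval_eq_gradient_dotProduct hL', smul_eq_mul]
    ring
  | add Q₁ hQ₁ Q₂ hQ₂ h₁ h₂ =>
    rw [← pow_two, homogeneousSubmodule_one_pow] at hQ₁ hQ₂
    have e : gradientAt (Q₁ + Q₂) v = gradientAt Q₁ v + gradientAt Q₂ v := by
      funext i
      simp [gradientAt]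
    rw [map_add, h₁ hQ₁, h₂ hQ₂, e, add_dotProduct, map_add, map_add]
    ring

theorem exists_binary_root (x y z : ℂ) :
    ∃ s t : ℂ, (s ≠ 0 ∨ t ≠ 0) ∧ s ^ 2 * x + s * t * y + t ^ 2 * z = 0 := by
  by_cases hx : x = 0
  · exact ⟨1, 0, Or.inl one_ne_zero, by rw [hx]; ring⟩
  · obtain ⟨d, hd⟩ := IsAlgClosed.exists_pow_nat_eq (y ^ 2 - 4 * x * z) (n := 2) (by norm_num)
    refine ⟨(-y + d) / (2 * x), 1, Or.inr one_ne_zero, ?_⟩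
    field_simp
    linear_combination hd

/-- A line and a conic that are nowhere tangent meet in exactly two points. -/
theorem ncard_commonPoints_line_conic {L Q : PlaneRing} (hL : L.IsHomogeneous 1) (hL0 : L ≠ 0)
    (hQ : Q.IsHomogeneous 2) (h : ∀ p ∈ commonPoints L Q,
      LinearIndependent ℂ ![gradientAt L p.rep, gradientAt Q p.rep]) :
    (commonPoints L Q).ncard = 2 := by
  set α := gradientAt L 0 with hα
  have hα0 : α ≠ 0 := gradientAt_ne_zero hL hL0
  have hmk : ∀ {v : Fin 3 → ℂ} (hv : v ≠ 0), α ⬝ᵥ v = 0 → eval v Q = 0 →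
      Projectivization.mk ℂ v hv ∈ commonPoints L Q := fun hv h1 h2 =>
    ⟨(eval_rep_mk_eq_zero_iff hL hv).2 (by rw [eval_eq_gradient_dotProduct hL, h1]),
      (eval_rep_mk_eq_zero_iff hQ hv).2 h2⟩
  obtain ⟨p, hp⟩ : (commonPoints L Q).Nonempty := by
    obtain ⟨v, hv, hv'⟩ := exists_ne_zero_dotProduct_eq_zero α
    rw [dotProduct_comm] at hv'
    obtain ⟨w, hvw, hw⟩ := exists_param_of_dotProduct_eq_zero hα0 hv hv'
    obtain ⟨s, t, hst, h0⟩ := exists_binary_root (eval v Q) (gradientAt Q v ⬝ᵥ w) (eval w Q)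
    have hne : s • v + t • w ≠ 0 := by
      intro h1
      have := LinearIndependent.pair_iff.1 hvw s t h1
      tauto
    exact ⟨_, hmk hne ((hw _).2 ⟨s, t, rfl⟩)
      (by rw [eval_add_of_isHomogeneous_two hQ, h0])⟩
  have hpL : α ⬝ᵥ p.rep = 0 := by rw [hα, ← eval_eq_gradient_dotProduct hL]; exact hp.1
  obtain ⟨w, hvw, hw⟩ := exists_param_of_dotProduct_eq_zero hα0 p.rep_nonzero hpL
  set v := p.rep with hv
  set β := gradientAt Q v ⬝ᵥ w with hβ
  have hβ0 : β ≠ 0 := by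
    intro h0
    have hli := crossProduct_ne_zero_iff_linearIndependent.2 (h p hp)
    rw [← hv, gradientAt_eq_of_isHomogeneous_one hL v 0, ← hα] at hli
    have h1 : gradientAt Q v ⬝ᵥ v = 0 := by rw [gradient_dotProduct_self hQ, hp.2, mul_zero]
    have h2 : α ⬝ᵥ w = 0 := (hw w).2 ⟨0, 1, by simp⟩
    rcases Configuration.ofField.crossProduct_eq_zero_of_dotProduct_eq_zero hpL h1 h2 h0 with h3 | h3
    · exact hli h3
    · exact crossProduct_ne_zero_iff_linearIndependent.2 hvw h3
  have hQst : ∀ s t : ℂ, eval (s • v + t • w) Q = t * (s * β + t * eval w Q) := by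
    intro s t
    rw [eval_add_of_isHomogeneous_two hQ, hp.2]
    ring
  -- Besides `v`, the second zero of `t (s β + t Q(w))` is `(s, t) = (-Q(w), β)`.
  have hu0 : (-eval w Q) • v + β • w ≠ 0 := fun h1 =>
    hβ0 (LinearIndependent.pair_iff.1 hvw _ _ h1).2
  rw [Set.ncard_eq_two]
  refine ⟨p, Projectivization.mk ℂ _ hu0, ?_, ?_⟩
  · intro hpu
    rw [← p.mk_rep, Projectivization.mk_eq_mk_iff'] at hpu
    obtain ⟨a, ha⟩ := hpu
    have h1 : (a * -eval w Q - 1) • v + (a * β) • w = 0 := by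
      rw [sub_smul, one_smul, mul_smul, mul_smul, sub_add_eq_add_sub, ← smul_add, ha, hv, sub_self]
    obtain ⟨h2, h3⟩ := LinearIndependent.pair_iff.1 hvw _ _ h1
    have ha0 : a = 0 := (mul_eq_zero.1 h3).resolve_right hβ0
    rw [ha0] at h2
    norm_num at h2
  · ext q
    rw [Set.mem_insert_iff, Set.mem_singleton_iff]
    constructor
    · rintro ⟨h1, h2⟩
      rw [eval_eq_gradient_dotProduct hL] at h1
      obtain ⟨s, t, hst⟩ := (hw _).1 h1
      rw [hst, hQst] at h2
      rcases mul_eq_zero.1 h2 with h3 | h3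
      · left
        rw [← q.mk_rep, ← p.mk_rep, Projectivization.mk_eq_mk_iff']
        exact ⟨s, by rw [hst, h3, zero_smul, add_zero]⟩
      · right
        rw [← q.mk_rep, Projectivization.mk_eq_mk_iff']
        refine ⟨t / β, ?_⟩
        have h4 : s = t / β * -eval w Q := by
          field_simp
          linear_combination h3
        rw [hst, smul_add, smul_smul, smul_smul, ← h4, div_mul_cancel₀ _ hβ0]
    · rintro (rfl | rfl)
      · exact hp
      · refine hmk hu0 ((hw _).2 ⟨_, _, rfl⟩) ?_
        rw [hQst]
        ring

end PlaneIntersections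

theorem HasZeroDimDegree.unique {I : Ideal PlaneRing} {t t' : ℕ} (h : HasZeroDimDegree I t)
    (h' : HasZeroDimDegree I t') : t = t' := by
  obtain ⟨j, h1, h2⟩ := (Eventually.and h h').exists
  exact h1.symm.trans h2

/-! ### Counting for conic-line arrangements -/

namespace ConicLineArrangement

variable {d k : ℕ} (A : ConicLineArrangement d k)

/-- The degree of a curve of an arrangement: `1` for a line, `2` for a conic. -/
def curveDegree : Fin d ⊕ Fin k → ℕ := Sum.elim (fun _ => 1) fun _ => 2

theorem isHomogeneous_curve (c : Fin d ⊕ Fin k) : (A.curve c).IsHomogeneous (curveDegree c) := by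
  rcases c with i | i
  exacts [A.line_homogeneous i, A.conic_homogeneous i]

theorem isHomogeneous_poly : A.poly.IsHomogeneous A.degree := by
  have := IsHomogeneous.prod Finset.univ A.curve curveDegree fun c _ => A.isHomogeneous_curve c
  have hsum : ∑ c : Fin d ⊕ Fin k, curveDegree c = d + 2 * k := by
    rw [Fintype.sum_sum_type]
    simp [curveDegree, mul_comm]
  rwa [hsum] at this

theorem gradientAt_curve_ne_zero (c : Fin d ⊕ Fin k) {v : Fin 3 → ℂ} (hv : v ≠ 0)
    (h : eval v (A.curve c) = 0) : gradientAt (A.curve c) v ≠ 0 := by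
  rcases c with i | i
  · change gradientAt (A.line i) v ≠ 0
    rw [gradientAt_eq_of_isHomogeneous_one (A.line_homogeneous i) v 0]
    exact gradientAt_ne_zero (A.line_homogeneous i) (A.line_ne_zero i)
  · exact A.conic_smooth i v hv h

open Classical in
/-- The curves through a point, as a finite set. -/
noncomputable def curvesAt (p : ProjPlane) : Finset (Fin d ⊕ Fin k) :=
  Finset.univ.filter fun c => eval p.rep (A.curve c) = 0

theorem mem_curvesAt {p : ProjPlane} {c : Fin d ⊕ Fin k} :
    c ∈ A.curvesAt p ↔ eval p.rep (A.curve c) = 0 := by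
  simp [curvesAt]

theorem multiplicity_eq_card (p : ProjPlane) : A.multiplicity p = (A.curvesAt p).card := by
  rw [multiplicity, ← Set.ncard_coe_finset]
  congr 1
  ext c
  simp [curvesThrough, mem_curvesAt]

theorem two_le_multiplicity_iff {p : ProjPlane} : 2 ≤ A.multiplicity p ↔
    ∃ c c', c ≠ c' ∧ p ∈ commonPoints (A.curve c) (A.curve c') := by
  rw [multiplicity_eq_card, ← Nat.lt_iff_add_one_le, Finset.one_lt_card]
  simp only [mem_curvesAt, commonPoints, Set.mem_ofPred_eq]
  constructor
  · rintro ⟨c, hc, c', hc', h⟩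
    exact ⟨c, c', h, hc, hc'⟩
  · rintro ⟨c, c', h, hc, hc'⟩
    exact ⟨c, hc, c', hc', h⟩

/-- Since the curves are smooth, the singular points of their union are the points that lie on two
of them. -/
theorem two_le_multiplicity_of_gradientAt_eq_zero (hdeg : A.degree ≠ 0) {v : Fin 3 → ℂ}
    (hv : v ≠ 0) (h : gradientAt A.poly v = 0) :
    2 ≤ A.multiplicity (Projectivization.mk ℂ v hv) := by
  classical
  have h0 : eval v A.poly = 0 := by
    have := gradient_dotProduct_self A.isHomogeneous_poly v
    rw [h, zero_dotProduct, eq_comm, mul_eq_zero] at this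
    exact this.resolve_left (by exact_mod_cast hdeg)
  rw [poly, map_prod, Finset.prod_eq_zero_iff] at h0
  obtain ⟨c, -, hc⟩ := h0
  have hsplit : A.poly = A.curve c * ∏ c' ∈ Finset.univ.erase c, A.curve c' :=
    (Finset.mul_prod_erase _ _ (Finset.mem_univ c)).symm
  set g := ∏ c' ∈ Finset.univ.erase c, A.curve c' with hg
  have hgrad : gradientAt A.poly v = eval v g • gradientAt (A.curve c) v := by
    funext i
    rw [hsplit]
    simp [gradientAt, Derivation.leibniz, hc]
  rw [h, eq_comm, smul_eq_zero] at hgrad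
  have hg0 := hgrad.resolve_right (A.gradientAt_curve_ne_zero c hv hc)
  rw [hg, map_prod, Finset.prod_eq_zero_iff] at hg0
  obtain ⟨c', hc', h'⟩ := hg0
  rw [two_le_multiplicity_iff]
  exact ⟨c, c', (Finset.ne_of_mem_erase hc').symm,
    (eval_rep_mk_eq_zero_iff (A.isHomogeneous_curve c) hv).2 hc,
    (eval_rep_mk_eq_zero_iff (A.isHomogeneous_curve c') hv).2 h'⟩

/-- An ordinary point of multiplicity `r ≤ 4` contributes `(r - 1)²` to the degree of the Jacobian
ideal. -/
theorem hasZeroDimDegree_jacobianIdeal_poly (hord : A.HasOrdinarySingularitiesLE 4)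
    (hdeg : A.degree ≠ 0) (P : Finset ProjPlane) (hP : ∀ p, p ∈ P ↔ 2 ≤ A.multiplicity p) :
    HasZeroDimDegree (jacobianIdeal A.poly) (∑ p ∈ P, (A.multiplicity p - 1) ^ 2) := by
  have hPmult : ∀ p : P, 2 ≤ A.multiplicity p := fun p => (hP p).1 p.2
  choose b hb using fun p : ProjPlane => exists_basis_zero_eq p.rep_nonzero
  have hlocal : ∀ p : P, chart (b p) A.poly ∈ idealOfVars (Fin 2) ℂ ^ A.multiplicity p ∧
      HasIndependentPartials (A.multiplicity p)
        (homogeneousComponent (A.multiplicity p) (chart (b p) A.poly)) := by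
    intro p
    have h2 := hPmult p
    rw [multiplicity_eq_card] at h2 ⊢
    refine chart_prod_mem_pow_and_hasIndependentPartials (b p) A.curve curveDegree
      A.isHomogeneous_curve (A.curvesAt p) (fun c => by rw [hb, mem_curvesAt]) h2
      fun c hc c' hc' hcc' => ?_
    rw [hb]
    exact (hord p (hPmult p)).1 c (A.mem_curvesAt.1 hc) c' (A.mem_curvesAt.1 hc') hcc'
  rw [← Finset.sum_coe_sort]
  refine hasZeroDimDegree_jacobianIdeal (fun p : P => b p) (fun p => A.multiplicity p)
    A.isHomogeneous_poly hPmult (fun p => (hord p (hPmult p)).2) (fun p => (hlocal p).1)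
    (fun p => (hlocal p).2) ?_ ?_
  · intro p q hpq z hz
    rw [hb, hb] at hz
    apply hpq
    apply Subtype.ext
    rw [← p.1.mk_rep, ← q.1.mk_rep, Projectivization.mk_eq_mk_iff']
    exact ⟨z, hz.symm⟩
  · intro v hv hgrad
    refine ⟨⟨_, (hP _).2 (A.two_le_multiplicity_of_gradientAt_eq_zero hdeg hv hgrad)⟩, ?_⟩
    obtain ⟨a, ha⟩ := Projectivization.exists_smul_eq_mk_rep ℂ v hv
    refine ⟨((a⁻¹ : ℂˣ) : ℂ), ?_⟩
    rw [hb, ← ha, ← Units.smul_def, inv_smul_smul]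

theorem sum_eq_of_multiplicity_le_four (hord : A.HasOrdinarySingularitiesLE 4)
    (P : Finset ProjPlane) (hP : ∀ p, p ∈ P ↔ 2 ≤ A.multiplicity p) (φ : ℕ → ℕ) :
    ∑ p ∈ P, φ (A.multiplicity p) =
      A.numPoints 2 * φ 2 + A.numPoints 3 * φ 3 + A.numPoints 4 * φ 4 := by
  classical
  have hcard : ∀ r, 2 ≤ r → ∑ p ∈ P with A.multiplicity p = r, φ (A.multiplicity p) =
      A.numPoints r * φ r := by
    intro r hr
    have h1 : A.numPoints r = (P.filter fun p => A.multiplicity p = r).card := by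
      rw [numPoints, ← Set.ncard_coe_finset]
      congr 1
      ext p
      simp only [Set.mem_ofPred_eq, Finset.coe_filter, hP]
      omega
    rw [h1, ← smul_eq_mul, ← Finset.sum_const]
    exact Finset.sum_congr rfl fun p hp => by rw [(Finset.mem_filter.1 hp).2]
  have hmaps : ∀ p ∈ P, A.multiplicity p ∈ Finset.Icc 2 4 := fun p hp =>
    Finset.mem_Icc.2 ⟨(hP p).1 hp, (hord p ((hP p).1 hp)).2⟩
  rw [← Finset.sum_fiberwise_of_maps_to hmaps,
    show Finset.Icc 2 4 = {2, 3, 4} by decide, Finset.sum_insert (by decide),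
    Finset.sum_insert (by decide), Finset.sum_singleton, hcard 2 (by omega), hcard 3 (by omega),
    hcard 4 (by omega), add_assoc]

/-- The number of common points of two different curves, when all intersections are transversal:
the product of the degrees. With a single conic, at least one of the two curves is a line. -/
theorem ncard_commonPoints_curve (A : ConicLineArrangement d 1)
    (hord : A.HasOrdinarySingularitiesLE 4) (c c' : Fin d ⊕ Fin 1) (h : c ≠ c') :
    (commonPoints (A.curve c) (A.curve c')).ncard = curveDegree c * curveDegree c' := by
  have hLC : ∀ i j, (commonPoints (A.line i) (A.conic j)).ncard = 2 := by
    intro i j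
    refine ncard_commonPoints_line_conic (A.line_homogeneous i) (A.line_ne_zero i)
      (A.conic_homogeneous j) fun p hp => ?_
    exact (hord p (A.two_le_multiplicity_iff.2 ⟨Sum.inl i, Sum.inr j, Sum.inl_ne_inr, hp⟩)).1
      (Sum.inl i) hp.1 (Sum.inr j) hp.2 Sum.inl_ne_inr
  rcases c with i | i <;> rcases c' with j | j
  · have hij : i ≠ j := fun hij => h (by rw [hij])
    exact ncard_commonPoints_line_line (A.line_homogeneous i) (A.line_homogeneous j)
      (A.line_ne_zero i) (A.line_ne_zero j) (A.line_distinct i j hij)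
  · exact hLC i j
  · rw [commonPoints_comm]
    exact hLC j i
  · exact absurd (by rw [Subsingleton.elim i j]) h

/-- Bézout's theorem for the arrangement, counting ordered pairs of different curves through
each point: the total is `d (d - 1) + 4 d`. -/
theorem sum_multiplicity_mul_pred (A : ConicLineArrangement d 1)
    (hord : A.HasOrdinarySingularitiesLE 4) (P : Finset ProjPlane)
    (hP : ∀ p, p ∈ P ↔ 2 ≤ A.multiplicity p) :
    ∑ p ∈ P, (A.multiplicity p * A.multiplicity p - A.multiplicity p) + d = d * d + 4 * d := by
  classical
  have h1 : ∀ p ∈ P, A.multiplicity p * A.multiplicity p - A.multiplicity p =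
      ∑ x ∈ (Finset.univ : Finset (Fin d ⊕ Fin 1)).offDiag,
        if p ∈ commonPoints (A.curve x.1) (A.curve x.2) then 1 else 0 := by
    intro p _
    rw [multiplicity_eq_card, ← Finset.offDiag_card, ← Finset.card_filter]
    congr 1
    ext x
    rw [Finset.mem_filter, Finset.mem_offDiag, Finset.mem_offDiag, mem_curvesAt, mem_curvesAt]
    exact ⟨fun h => ⟨⟨Finset.mem_univ _, Finset.mem_univ _, h.2.2⟩, h.1, h.2.1⟩,
      fun h => ⟨h.2.1, h.2.2, h.1.2.2⟩⟩
  have h2 : ∀ x ∈ (Finset.univ : Finset (Fin d ⊕ Fin 1)).offDiag,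
      (∑ p ∈ P, if p ∈ commonPoints (A.curve x.1) (A.curve x.2) then 1 else 0) =
        curveDegree x.1 * curveDegree x.2 := by
    intro x hx
    have hne := (Finset.mem_offDiag.1 hx).2.2
    rw [← Finset.card_filter, ← A.ncard_commonPoints_curve hord _ _ hne, ← Set.ncard_coe_finset]
    congr 1
    ext p
    rw [Finset.coe_filter, Set.mem_ofPred_eq, hP]
    exact ⟨fun h => h.2, fun h => ⟨A.two_le_multiplicity_iff.2 ⟨_, _, hne, h⟩, h⟩⟩
  rw [Finset.sum_congr rfl h1, Finset.sum_comm, Finset.sum_congr rfl h2]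
  -- The diagonal terms are the squares of the degrees.
  have h3 : ∑ x ∈ (Finset.univ : Finset (Fin d ⊕ Fin 1)).diag, curveDegree x.1 * curveDegree x.2 =
      d + 4 := by
    rw [Finset.sum_diag, Fintype.sum_sum_type]
    simp [curveDegree]
  have h4 : ∑ x : (Fin d ⊕ Fin 1) × (Fin d ⊕ Fin 1), curveDegree x.1 * curveDegree x.2 =
      (d + 2) * (d + 2) := by
    rw [Fintype.sum_prod_type, ← Finset.sum_mul_sum, Fintype.sum_sum_type]
    simp [curveDegree]
  have h5 := Finset.sum_union (Finset.disjoint_diag_offDiag (Finset.univ : Finset (Fin d ⊕ Fin 1)))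
    (f := fun x => curveDegree x.1 * curveDegree x.2)
  rw [Finset.diag_union_offDiag, Finset.univ_product_univ, h3, h4] at h5
  linarith

theorem finite_setOf_two_le_multiplicity (A : ConicLineArrangement d 1)
    (hord : A.HasOrdinarySingularitiesLE 4) : {p | 2 ≤ A.multiplicity p}.Finite := by
  have h : {p | 2 ≤ A.multiplicity p} ⊆ ⋃ x ∈ {x : (Fin d ⊕ Fin 1) × (Fin d ⊕ Fin 1) | x.1 ≠ x.2},
      commonPoints (A.curve x.1) (A.curve x.2) := by
    intro p hp
    obtain ⟨c, c', hne, hcc'⟩ := A.two_le_multiplicity_iff.1 hp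
    exact Set.mem_biUnion (x := (c, c')) hne hcc'
  refine ((Set.toFinite _).biUnion fun x hx => Set.finite_of_ncard_ne_zero ?_).subset h
  rw [A.ncard_commonPoints_curve hord _ _ hx]
  rcases x with ⟨c | c, c' | c'⟩ <;> simp [curveDegree]

end ConicLineArrangement

theorem proposition3p4 (d : ℕ) (hd : 3 ≤ d) (A : ConicLineArrangement d 1)
    (hA : A.IsOrdinaryMArrangement) :
    (∀ l : ℕ, d = 2 * l →
      (A.numPoints 2 : ℤ) + A.numPoints 3 = 3 * l - 6 ∧
      (A.numPoints 3 : ℤ) + 3 * A.numPoints 4 = l ^ 2 + 3) ∧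
    (∀ l : ℕ, d = 2 * l + 1 →
      (A.numPoints 2 : ℤ) + A.numPoints 3 = 3 * l - 2 ∧
      (A.numPoints 3 : ℤ) + 3 * A.numPoints 4 = l ^ 2 + l + 2) := by
  have hfin := A.finite_setOf_two_le_multiplicity hA.ordinary
  have hP : ∀ p, p ∈ hfin.toFinset ↔ 2 ≤ A.multiplicity p := fun p => by simp
  have hdeg : A.degree = d + 2 := rfl
  have hdegree := A.hasZeroDimDegree_jacobianIdeal_poly hA.ordinary (by omega) hfin.toFinset hP
  have hbezout := A.sum_multiplicity_mul_pred hA.ordinary hfin.toFinset hP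
  rw [A.sum_eq_of_multiplicity_le_four hA.ordinary _ hP fun m => (m - 1) ^ 2] at hdegree
  rw [A.sum_eq_of_multiplicity_le_four hA.ordinary _ hP fun m => m * m - m] at hbezout
  norm_num at hdegree hbezout
  constructor
  · rintro l rfl
    have h := hdegree.unique (hA.degree_even (l + 1) (by omega))
    rw [show 3 * (l + 1) ^ 2 - 3 * (l + 1) + 3 = 3 * l ^ 2 + 3 * l + 3 by
      rw [show 3 * (l + 1) ^ 2 = 3 * l ^ 2 + 3 * l + 3 * (l + 1) by ring, Nat.add_sub_cancel]] at h
    zify at h hbezout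
    constructor <;> linarith
  · rintro l rfl
    have h := hdegree.unique (hA.degree_odd (l + 1) (by omega))
    zify at h hbezout
    constructor <;> linarith
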